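/- Consider finite sets of unit cells of the square lattice $\mathbb{Z}^2$, taken up to translation. A \emph{parallelogram polyomino} is a nonempty finite edge-connected set of cells, each of whose rows and columns is contiguous, that contains both the bottom-left and the top-right cell of its minimal bounding rectangle. Its \emph{area} is its number of cells, and its \emph{half-perimeter} is the sum of the width and the height of its minimal bounding rectangle. Let $\mathfrak{D}_2=\{1,r^2,d_1,d_2\}$ be the group generated by the rotation $r^2:(x,y)\mapsto(-x,-y)$ and the reflection $d_1:(x,y)\mapsto(-y,-x)$, so that $d_2:(x,y)\mapsto(y,x)$; it acts on parallelogram polyominoes up to translation. For a subgroup $H\le\mathfrak{D}_2$, a parallelogram polyomino is \emph{$H$-symmetric} if it is invariant, up to translation, under every element of $H$. For an integer $n \ge 0$ let $p_n^{(q)}$ (resp. $p_n^{(t)}$) be the number of parallelogram polyominoes of area (resp. half-perimeter) $n$, and let $P_H^{(q)}(n)$ (resp. $P_H^{(t)}(n)$) be the number of those that are $H$-symmetric. Then for every non-trivial subgroup $H$ of $\mathfrak{D}_2$ (that is, $H\neq\{1\}$, with $H=\mathfrak{D}_2$ allowed), $$\lim_{n\to\infty}\frac{P_H^{(q)}(n)}{p_n^{(q)}}=0\qquad\text{and}\qquad\lim_{n\to\infty}\frac{P_H^{(t)}(n)}{p_n^{(t)}}=0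 .$$ -/

import Mathlib

open Filter Topology

/-- A cell of the square lattice; `(i, j)` is the unit square in column `i` and row `j`
(columns are numbered from left to right, rows from bottom to top). -/
abbrev Cell : Type := ℤ × ℤ

/-- Two cells are adjacent when they share an edge. -/
def cellGraph : SimpleGraph Cell where
  Adj a b := (a.1 = b.1 ∧ |a.2 - b.2| = 1) ∨ (a.2 = b.2 ∧ |a.1 - b.1| = 1)
  symm := ⟨fun a b h => by
    rw [abs_sub_comm b.2, abs_sub_comm b.1, eq_comm (a := b.1), eq_comm (a := b.2)]
    exact h⟩
  loopless := ⟨fun a h => by simp at h⟩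

/-- A polyomino, in a fixed position: a nonempty finite edge-connected set of cells
(`SimpleGraph.Connected` includes nonemptiness). -/
def IsPolyomino (S : Finset Cell) : Prop :=
  (cellGraph.induce (S : Set Cell)).Connected

/-- Every column of `S` is a contiguous block of cells. -/
def IsVerticallyConvex (S : Finset Cell) : Prop :=
  ∀ i j₁ j j₂ : ℤ, (i, j₁) ∈ S → (i, j₂) ∈ S → j₁ ≤ j → j ≤ j₂ → (i, j) ∈ S

/-- Every row of `S` is a contiguous block of cells. -/
def IsHorizontallyConvex (S : Finset Cell) : Prop :=
  ∀ i₁ i i₂ j : ℤ, (i₁, j) ∈ S → (i₂, j) ∈ S → i₁ ≤ i → i ≤ i₂ → (i, j) ∈ S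

/-- Parallelogram (staircase) polyominoes: convex polyominoes containing the bottom-left and the
top-right cell of their minimal bounding rectangle. The order on `ℤ × ℤ` is componentwise, so a
least (greatest) element of `S` is exactly a cell of `S` in that corner. -/
structure IsParallelogramPolyomino (S : Finset Cell) : Prop where
  isPolyomino : IsPolyomino S
  verticallyConvex : IsVerticallyConvex S
  horizontallyConvex : IsHorizontallyConvex S
  bottomLeft : ∃ a : Cell, IsLeast (S : Set Cell) a
  topRight : ∃ b : Cell, IsGreatest (S : Set Cell) b

/-- The translate of `S` by the vector `v`. -/
def translateCells (v : Cell) (S : Finset Cell) : Finset Cell :=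
  S.map (Equiv.addLeft v).toEmbedding

theorem mem_translateCells {v a : Cell} {S : Finset Cell} :
    a ∈ translateCells v S ↔ -v + a ∈ S := by
  constructor
  · intro h
    obtain ⟨b, hb, rfl⟩ := Finset.mem_map.1 h
    simpa using hb
  · intro h
    exact Finset.mem_map.2 ⟨-v + a, h, by simp⟩

/-- Two finite sets of cells are identified when they differ by a translation. -/
instance translationSetoid : Setoid (Finset Cell) where
  r S T := ∃ v : Cell, translateCells v S = T
  iseqv :=
    { refl := fun S => ⟨0, by ext a; simp [mem_translateCells]⟩
      symm := by
        rintro S T ⟨v, rfl⟩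
        exact ⟨-v, by ext a; simp [mem_translateCells]⟩
      trans := by
        rintro S T U ⟨v, rfl⟩ ⟨w, rfl⟩
        exact ⟨w + v, by ext a; simp [mem_translateCells, add_assoc]⟩ }

/-- Finite sets of cells up to translation. -/
abbrev TranslationClass : Type := Quotient translationSetoid

/-- The image of a finite set of cells under a lattice automorphism. -/
def moveCells (g : Cell ≃ₗ[ℤ] Cell) (S : Finset Cell) : Finset Cell :=
  S.map g.toEquiv.toEmbedding

/-- The number of columns met by `S`, that is, the width of the bounding rectangle when `S` is
connected. -/
def width (S : Finset Cell) : ℕ := (S.image Prod.fst).card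

/-- The number of rows met by `S`, that is, the height of the bounding rectangle when `S` is
connected. -/
def height (S : Finset Cell) : ℕ := (S.image Prod.snd).card

theorem card_translateCells (v : Cell) (S : Finset Cell) : (translateCells v S).card = S.card := by
  simp [translateCells]

theorem width_translateCells (v : Cell) (S : Finset Cell) : width (translateCells v S) = width S := by
  have h : (translateCells v S).image Prod.fst = (S.image Prod.fst).image (fun x => v.1 + x) := by
    rw [translateCells, Finset.map_eq_image, Finset.image_image, Finset.image_image]
    rfl
  rw [width, h, Finset.card_image_of_injective _ (add_right_injective v.1), width]

theorem height_translateCells (v : Cell) (S : Finset Cell) :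
    height (translateCells v S) = height S := by
  have h : (translateCells v S).image Prod.snd = (S.image Prod.snd).image (fun x => v.2 + x) := by
    rw [translateCells, Finset.map_eq_image, Finset.image_image, Finset.image_image]
    rfl
  rw [height, h, Finset.card_image_of_injective _ (add_right_injective v.2), height]

theorem moveCells_translate (g : Cell ≃ₗ[ℤ] Cell) (v : Cell) (S : Finset Cell) :
    moveCells g (translateCells v S) = translateCells (g v) (moveCells g S) := by
  ext a; simp [moveCells, translateCells]

namespace TranslationClass

/-- The area: the number of cells. -/
def area : TranslationClass → ℕ :=
  Quotient.lift Finset.card (by rintro S T ⟨v, rfl⟩; exact (card_translateCells v S).symm)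

/-- The half-perimeter: width plus height. -/
def halfPerimeter : TranslationClass → ℕ :=
  Quotient.lift (fun S => width S + height S) (by
    rintro S T ⟨v, rfl⟩; simp only [width_translateCells, height_translateCells])

/-- The action of lattice automorphisms on translation classes. -/
def move (g : Cell ≃ₗ[ℤ] Cell) : TranslationClass → TranslationClass :=
  Quotient.map (moveCells g) (by
    rintro S T ⟨v, rfl⟩; exact ⟨g v, (moveCells_translate g v S).symm⟩)

/-- `c` is the translation class of a parallelogram polyomino. -/
def IsParallelogram (c : TranslationClass) : Prop :=
  ∃ S : Finset Cell, IsParallelogramPolyomino S ∧ (⟦S⟧ : TranslationClass) = c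

/-- `c` is invariant under every element of `H`. -/
def IsSymmetric (H : Subgroup (Cell ≃ₗ[ℤ] Cell)) (c : TranslationClass) : Prop :=
  ∀ g ∈ H, move g c = c

end TranslationClass

/-- The rotation `r²` by `180°`. -/
def symR2 : Cell ≃ₗ[ℤ] Cell := LinearEquiv.neg ℤ

/-- The reflection `d₂` about the bisector of the first quadrant, `(x, y) ↦ (y, x)`. -/
def symD2 : Cell ≃ₗ[ℤ] Cell := LinearEquiv.prodComm ℤ ℤ ℤ

/-- The reflection `d₁` about the other diagonal, `(x, y) ↦ (-y, -x)`. -/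
def symD1 : Cell ≃ₗ[ℤ] Cell := (LinearEquiv.prodComm ℤ ℤ ℤ).trans (LinearEquiv.neg ℤ)

/-- The group `𝔇₂ = ⟨r², d₁⟩` of the symmetries of the square preserving the class of
parallelogram polyominoes. -/
def groupD2 : Subgroup (Cell ≃ₗ[ℤ] Cell) := Subgroup.closure {symR2, symD1}

/-- `𝔇₂ = {1, r², d₁, d₂}`. -/
theorem mem_groupD2 (g : Cell ≃ₗ[ℤ] Cell) :
    g ∈ groupD2 ↔ g = 1 ∨ g = symR2 ∨ g = symD1 ∨ g = symD2 := by
  have e1 : symR2 * symR2 = 1 := by ext a <;> simp [symR2]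
  have e2 : symD1 * symD1 = 1 := by ext a <;> simp [symD1]
  have e3 : symR2 * symD1 = symD2 := by ext a <;> simp [symR2, symD1, symD2]
  have e4 : symR2 * symD2 = symD1 := by ext a <;> simp [symR2, symD1, symD2]
  have e5 : symD1 * symR2 = symD2 := by ext a <;> simp [symR2, symD1, symD2]
  have e6 : symD1 * symD2 = symR2 := by ext a <;> simp [symR2, symD1, symD2]
  have i1 : symR2⁻¹ = symR2 := inv_eq_of_mul_eq_one_left e1
  have i2 : symD1⁻¹ = symD1 := inv_eq_of_mul_eq_one_left e2
  constructor
  · intro h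
    induction h using Subgroup.closure_induction_left with
    | one => exact Or.inl rfl
    | mul_left x hx y _ ih =>
      rcases hx with rfl | rfl <;> rcases ih with rfl | rfl | rfl | rfl <;> simp [*]
    | inv_mul_cancel x hx y _ ih =>
      rcases hx with rfl | rfl <;> rcases ih with rfl | rfl | rfl | rfl <;> simp [*]
  · have h1 : symR2 ∈ groupD2 := Subgroup.subset_closure (by simp)
    have h2 : symD1 ∈ groupD2 := Subgroup.subset_closure (by simp)
    rintro (rfl | rfl | rfl | rfl)
    · exact one_mem _
    · exact h1
    · exact h2
    · exact e3 ▸ mul_mem h1 h2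

/-- The number of parallelogram polyominoes (up to translation) of area `n`. -/
noncomputable def countByArea (n : ℕ) : ℕ :=
  {c : TranslationClass | c.IsParallelogram ∧ c.area = n}.ncard

/-- The number of parallelogram polyominoes (up to translation) of half-perimeter `n`. -/
noncomputable def countByHalfPerimeter (n : ℕ) : ℕ :=
  {c : TranslationClass | c.IsParallelogram ∧ c.halfPerimeter = n}.ncard

/-- The number of `H`-symmetric parallelogram polyominoes of area `n`. -/
noncomputable def symmetricCountByArea (H : Subgroup (Cell ≃ₗ[ℤ] Cell)) (n : ℕ) : ℕ :=
  {c : TranslationClass | c.IsParallelogram ∧ c.IsSymmetric H ∧ c.area = n}.ncard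

/-- The number of `H`-symmetric parallelogram polyominoes of half-perimeter `n`. -/
noncomputable def symmetricCountByHalfPerimeter (H : Subgroup (Cell ≃ₗ[ℤ] Cell)) (n : ℕ) : ℕ :=
  {c : TranslationClass | c.IsParallelogram ∧ c.IsSymmetric H ∧ c.halfPerimeter = n}.ncard

/-! Place the bottom-left cell at the origin and cut a parallelogram polyomino along the
antidiagonals `x + y = s`. Each slice is an interval `[lo s, hi s]` of columns, and from one slice
to the next each end either stays or moves by one (`IsStair`); conversely, all such pairs of ends
give parallelogram polyominoes. The area is the sum of the slice lengths, and the half-perimeter is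
`N + 2`, where `N` is the last antidiagonal. Counting polyominoes thus becomes counting words over
the four pairs of steps.

Lower bounds for all polyominoes: slices of length at most two are coded by ternary words, giving `3
^ m` of half-perimeter `m + 3`; slices of length one give `2 ^ m` of area `m + 2`.

Upper bounds for symmetric ones: a single nontrivial `g ∈ H` suffices. The maps `symR2` and `symD1`
reverse the order of the slices, so the first half and the top-right cell determine everything. This
leaves at most `4 ^ (n / 2) ≤ 2 ^ n` words for half-perimeter, and words using at most half the
area, of which `exists_finset_admissibleWord` allows fewer than `2 * 3 ^ (n / 2)`, where `√3 < 7/4`.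
The map `symD2` preserves each slice and forces `lo s + hi s = s`, so only two of the four steps
survive: at most `2 ^ n` and `2 * (7/4) ^ n` words. The top-right cell costs a factor `(n + 1) ^ 2`,
so the ratios are `O(n² (7/8)ⁿ)` for area and `O(n² (2/3)ⁿ)` for half-perimeter. -/

/-! ### Consequences of connectedness and convexity. -/

/-- A connected set of cells that meets both a predicate and its negation contains two adjacent
cells on which the predicate changes. -/
theorem IsPolyomino.exists_crossing {S : Finset Cell} (h : IsPolyomino S) (P : Cell → Prop)
    {a b : Cell} (ha : a ∈ S) (hb : b ∈ S) (hPa : P a) (hPb : ¬ P b) :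
    ∃ u ∈ S, ∃ v ∈ S, cellGraph.Adj u v ∧ P u ∧ ¬ P v := by
  obtain ⟨w⟩ := h.preconnected ⟨a, ha⟩ ⟨b, hb⟩
  obtain ⟨d, -, h1, h2⟩ := w.exists_boundary_dart {x | P x.1} hPa hPb
  exact ⟨d.fst.1, d.fst.2, d.snd.1, d.snd.2, d.adj, h1, h2⟩

theorem cellGraph_adj_cases {u v : Cell} (h : cellGraph.Adj u v) :
    (u.1 = v.1 ∧ (u.2 = v.2 + 1 ∨ v.2 = u.2 + 1)) ∨
      (u.2 = v.2 ∧ (u.1 = v.1 + 1 ∨ v.1 = u.1 + 1)) := by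
  rcases h with ⟨h1, h2⟩ | ⟨h1, h2⟩ <;> rw [abs_eq (by norm_num)] at h2
  · left; omega
  · right; omega

namespace IsParallelogramPolyomino

variable {S : Finset Cell}

/-- Otherwise convexity empties the whole rays going right and up from the cell. They border the
open quadrant that contains `b`, and a chain of adjacent cells cannot leave this quadrant without
touching one of them. -/
theorem exists_succ (h : IsParallelogramPolyomino S) {b : Cell} (hb : IsGreatest (S : Set Cell) b)
    {x y : ℤ} (hp : (x, y) ∈ S) (hne : (x, y) ≠ b) : (x + 1, y) ∈ S ∨ (x, y + 1) ∈ S := by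
  by_contra! hc
  obtain ⟨h1, h2⟩ := hc
  have hr : ∀ X, x < X → (X, y) ∉ S := fun X hX hm =>
    h1 (h.horizontallyConvex _ _ _ _ hp hm (by omega) (by omega))
  have hu : ∀ Y, y < Y → (x, Y) ∉ S := fun Y hY hm =>
    h2 (h.verticallyConvex _ _ _ _ hp hm (by omega) (by omega))
  obtain ⟨b1, b2⟩ := b
  have hbS : (b1, b2) ∈ S := hb.1
  have hle : x ≤ b1 ∧ y ≤ b2 := hb.2 hp
  have hx : x < b1 := by
    rcases hle.1.lt_or_eq with h' | rfl
    · exact h'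
    · rcases hle.2.lt_or_eq with h' | rfl
      · exact absurd hbS (hu _ h')
      · exact absurd rfl hne
  have hy : y < b2 := by
    rcases hle.2.lt_or_eq with h' | rfl
    · exact h'
    · exact absurd hbS (hr _ hx)
  obtain ⟨⟨u1, u2⟩, hu', ⟨v1, v2⟩, hv', hadj, hPu, hPv⟩ :=
    h.isPolyomino.exists_crossing (fun p => x < p.1 ∧ y < p.2) hbS hp ⟨hx, hy⟩ (by simp)
  have hA := cellGraph_adj_cases hadj
  simp only at hA hPu hPv
  rcases (by omega : (v1 = x ∧ y < v2) ∨ (v2 = y ∧ x < v1)) with ⟨rfl, hh⟩ | ⟨rfl, hh⟩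
  · exact hu _ hh hv'
  · exact hr _ hh hv'

theorem exists_pred (h : IsParallelogramPolyomino S) {a : Cell} (ha : IsLeast (S : Set Cell) a)
    {x y : ℤ} (hp : (x, y) ∈ S) (hne : (x, y) ≠ a) : (x - 1, y) ∈ S ∨ (x, y - 1) ∈ S := by
  by_contra! hc
  obtain ⟨h1, h2⟩ := hc
  have hr : ∀ X, X < x → (X, y) ∉ S := fun X hX hm =>
    h1 (h.horizontallyConvex _ _ _ _ hm hp (by omega) (by omega))
  have hu : ∀ Y, Y < y → (x, Y) ∉ S := fun Y hY hm =>
    h2 (h.verticallyConvex _ _ _ _ hm hp (by omega) (by omega))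
  obtain ⟨b1, b2⟩ := a
  have hbS : (b1, b2) ∈ S := ha.1
  have hle : b1 ≤ x ∧ b2 ≤ y := ha.2 hp
  have hx : b1 < x := by
    rcases hle.1.lt_or_eq with h' | rfl
    · exact h'
    · rcases hle.2.lt_or_eq with h' | rfl
      · exact absurd hbS (hu _ h')
      · exact absurd rfl hne
  have hy : b2 < y := by
    rcases hle.2.lt_or_eq with h' | rfl
    · exact h'
    · exact absurd hbS (hr _ hx)
  obtain ⟨⟨u1, u2⟩, hu', ⟨v1, v2⟩, hv', hadj, hPu, hPv⟩ :=
    h.isPolyomino.exists_crossing (fun p => p.1 < x ∧ p.2 < y) hbS hp ⟨hx, hy⟩ (by simp)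
  have hA := cellGraph_adj_cases hadj
  simp only at hA hPu hPv
  rcases (by omega : (v1 = x ∧ v2 < y) ∨ (v2 = y ∧ v1 < x)) with ⟨rfl, hh⟩ | ⟨rfl, hh⟩
  · exact hu _ hh hv'
  · exact hr _ hh hv'

/-- A parallelogram polyomino contains every rectangle of which it contains the top-left and the
bottom-right cell. -/
theorem mem_of_antirectangle (h : IsParallelogramPolyomino S) {x₁ y₁ x₂ y₂ x y : ℤ}
    (h₁ : (x₁, y₁) ∈ S) (h₂ : (x₂, y₂) ∈ S) (hx₁ : x₁ ≤ x) (hx₂ : x ≤ x₂) (hy₁ : y ≤ y₁)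
    (hy₂ : y₂ ≤ y) : (x, y) ∈ S := by
  by_contra hn
  obtain ⟨⟨a1, a2⟩, ha⟩ := h.bottomLeft
  obtain ⟨⟨b1, b2⟩, hb⟩ := h.topRight
  have haS : (a1, a2) ∈ S := ha.1
  have hbS : (b1, b2) ∈ S := hb.1
  have ha₁ : a1 ≤ x₁ ∧ a2 ≤ y₁ := ha.2 h₁
  have ha₂ : a1 ≤ x₂ ∧ a2 ≤ y₂ := ha.2 h₂
  have hb₁ : x₁ ≤ b1 ∧ y₁ ≤ b2 := hb.2 h₁
  have hb₂ : x₂ ≤ b1 ∧ y₂ ≤ b2 := hb.2 h₂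
  -- By convexity a missing cell has an empty horizontal ray and an empty vertical ray. In each of
  -- the four cases these border a quadrant that separates two cells of `S`, chosen among the two
  -- corners and the two given cells.
  have hrow : (∀ X, x ≤ X → (X, y) ∉ S) ∨ (∀ X, X ≤ x → (X, y) ∉ S) := by
    by_contra! hc
    obtain ⟨⟨X, hX, hXS⟩, X', hX', hXS'⟩ := hc
    exact hn (h.horizontallyConvex _ _ _ _ hXS' hXS hX' hX)
  have hcol : (∀ Y, y ≤ Y → (x, Y) ∉ S) ∨ (∀ Y, Y ≤ y → (x, Y) ∉ S) := by
    by_contra! hc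
    obtain ⟨⟨X, hX, hXS⟩, X', hX', hXS'⟩ := hc
    exact hn (h.verticallyConvex _ _ _ _ hXS' hXS hX' hX)
  have ne_of : ∀ {p q : ℤ}, (p, q) ∈ S → (x, q) ∉ S → p ≠ x := by
    rintro p q hp hq rfl; exact hq hp
  have ne_of' : ∀ {p q : ℤ}, (p, q) ∈ S → (p, y) ∉ S → q ≠ y := by
    rintro p q hp hq rfl; exact hq hp
  rcases hrow with hr | hr <;> rcases hcol with hc | hc
  · have k1 := ne_of hbS (hc _ (by omega))
    have k2 := ne_of' hbS (hr _ (by omega))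
    have k3 := ne_of' h₂ (hr _ (by omega))
    obtain ⟨⟨u1, u2⟩, hu', ⟨v1, v2⟩, hv', hadj, hPu, hPv⟩ :=
      h.isPolyomino.exists_crossing (fun p => x < p.1 ∧ y < p.2) hbS h₂
        (by simp only; omega) (by simp only; omega)
    have hA := cellGraph_adj_cases hadj
    simp only at hA hPu hPv
    rcases (by omega : (v1 = x ∧ y ≤ v2) ∨ (v2 = y ∧ x ≤ v1)) with ⟨rfl, hh⟩ | ⟨rfl, hh⟩
    · exact hc _ hh hv'
    · exact hr _ hh hv'
  · have k1 := ne_of h₂ (hc _ (by omega))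
    have k2 := ne_of' h₂ (hr _ (by omega))
    obtain ⟨⟨u1, u2⟩, hu', ⟨v1, v2⟩, hv', hadj, hPu, hPv⟩ :=
      h.isPolyomino.exists_crossing (fun p => x < p.1 ∧ p.2 < y) h₂ h₁
        (by simp only; omega) (by simp only; omega)
    have hA := cellGraph_adj_cases hadj
    simp only at hA hPu hPv
    rcases (by omega : (v1 = x ∧ v2 ≤ y) ∨ (v2 = y ∧ x ≤ v1)) with ⟨rfl, hh⟩ | ⟨rfl, hh⟩
    · exact hc _ hh hv'
    · exact hr _ hh hv'
  · have k1 := ne_of h₁ (hc _ (by omega))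
    have k2 := ne_of' h₁ (hr _ (by omega))
    obtain ⟨⟨u1, u2⟩, hu', ⟨v1, v2⟩, hv', hadj, hPu, hPv⟩ :=
      h.isPolyomino.exists_crossing (fun p => p.1 < x ∧ y < p.2) h₁ h₂
        (by simp only; omega) (by simp only; omega)
    have hA := cellGraph_adj_cases hadj
    simp only at hA hPu hPv
    rcases (by omega : (v1 = x ∧ y ≤ v2) ∨ (v2 = y ∧ v1 ≤ x)) with ⟨rfl, hh⟩ | ⟨rfl, hh⟩
    · exact hc _ hh hv'
    · exact hr _ hh hv'
  · have k1 := ne_of haS (hc _ (by omega))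
    have k2 := ne_of' haS (hr _ (by omega))
    have k3 := ne_of' h₁ (hr _ (by omega))
    obtain ⟨⟨u1, u2⟩, hu', ⟨v1, v2⟩, hv', hadj, hPu, hPv⟩ :=
      h.isPolyomino.exists_crossing (fun p => p.1 < x ∧ p.2 < y) haS h₁
        (by simp only; omega) (by simp only; omega)
    have hA := cellGraph_adj_cases hadj
    simp only at hA hPu hPv
    rcases (by omega : (v1 = x ∧ v2 ≤ y) ∨ (v2 = y ∧ v1 ≤ x)) with ⟨rfl, hh⟩ | ⟨rfl, hh⟩
    · exact hc _ hh hv'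
    · exact hr _ hh hv'

end IsParallelogramPolyomino

/-! ### Encoding by antidiagonals. -/

/-- The lower and upper ends (measured by the column) of the antidiagonals of a parallelogram
polyomino with bottom-left cell `(0, 0)` whose last antidiagonal is `x + y = N`. -/
structure IsStair (N : ℕ) (lo hi : ℕ → ℤ) : Prop where
  lo_zero : lo 0 = 0
  hi_zero : hi 0 = 0
  lo_le_succ : ∀ s, lo s ≤ lo (s + 1)
  lo_succ_le : ∀ s, lo (s + 1) ≤ lo s + 1
  hi_le_succ : ∀ s, hi s ≤ hi (s + 1)
  hi_succ_le : ∀ s, hi (s + 1) ≤ hi s + 1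
  lo_le_hi : ∀ s, lo s ≤ hi s
  last : lo N = hi N

/-- The cells `(x, y)` with `x + y = s ≤ N` and `lo s ≤ x ≤ hi s`. -/
noncomputable def stairSet (N : ℕ) (lo hi : ℕ → ℤ) : Finset Cell :=
  (Finset.range (N + 1)).biUnion fun s =>
    (Finset.Icc (lo s) (hi s)).image fun x : ℤ => ((x, (s : ℤ) - x) : Cell)

theorem mem_stairSet {N : ℕ} {lo hi : ℕ → ℤ} {p : Cell} :
    p ∈ stairSet N lo hi ↔ ∃ s ≤ N, p.1 + p.2 = s ∧ lo s ≤ p.1 ∧ p.1 ≤ hi s := by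
  obtain ⟨x, y⟩ := p
  simp only [stairSet, Finset.mem_biUnion, Finset.mem_range, Finset.mem_image, Finset.mem_Icc,
    Prod.mk.injEq, Order.lt_add_one_iff]
  constructor
  · rintro ⟨s, hs, z, hz, rfl, rfl⟩
    exact ⟨s, hs, by ring, hz⟩
  · rintro ⟨s, hs, h1, h2⟩
    exact ⟨s, hs, x, h2, rfl, by omega⟩

theorem mem_stairSet_of_add_eq {N : ℕ} {lo hi : ℕ → ℤ} {s : ℕ} {x y : ℤ} (h : x + y = s) :
    (x, y) ∈ stairSet N lo hi ↔ s ≤ N ∧ lo s ≤ x ∧ x ≤ hi s := by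
  rw [mem_stairSet]
  constructor
  · rintro ⟨t, ht, h1, h2⟩
    obtain rfl : s = t := by simp only at h1; omega
    exact ⟨ht, h2⟩
  · rintro ⟨h1, h2⟩
    exact ⟨s, h1, h, h2⟩

theorem IsParallelogramPolyomino.exists_stair {S : Finset Cell} (h : IsParallelogramPolyomino S) :
    ∃ N lo hi, IsStair N lo hi ∧
      (⟦stairSet N lo hi⟧ : TranslationClass) = ⟦S⟧ := by
  obtain ⟨⟨a1, a2⟩, ha⟩ := h.bottomLeft
  obtain ⟨⟨b1, b2⟩, hb⟩ := h.topRight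
  have haS : (a1, a2) ∈ S := ha.1
  have hbS : (b1, b2) ∈ S := hb.1
  have hab : a1 ≤ b1 ∧ a2 ≤ b2 := hb.2 haS
  have hlow : ∀ {x y}, (x, y) ∈ S → a1 ≤ x ∧ a2 ≤ y := fun hm => ha.2 hm
  have hupp : ∀ {x y}, (x, y) ∈ S → x ≤ b1 ∧ y ≤ b2 := fun hm => hb.2 hm
  obtain ⟨N, hN⟩ : ∃ N : ℕ, (N : ℤ) = (b1 - a1) + (b2 - a2) :=
    ⟨((b1 - a1) + (b2 - a2)).toNat, by omega⟩
  -- every antidiagonal is met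
  have hdiag : ∀ s : ℕ, s ≤ N → ∃ x : ℤ, (a1 + x, a2 + (s - x)) ∈ S := by
    intro s
    induction s with
    | zero => intro _; exact ⟨0, by simpa using haS⟩
    | succ s ih =>
      intro hs
      obtain ⟨x, hx⟩ := ih (by omega)
      rcases h.exists_succ hb hx (by simp only [ne_eq, Prod.mk.injEq]; omega) with h' | h'
      · exact ⟨x + 1, by convert h' using 2 <;> push_cast <;> ring⟩
      · exact ⟨x, by convert h' using 2; push_cast; ring⟩
  have hex : ∀ s : ℕ, ∃ l u : ℤ, l ≤ u ∧
      (s ≤ N → ∀ x : ℤ, (a1 + x, a2 + (s - x)) ∈ S ↔ l ≤ x ∧ x ≤ u) ∧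
      (N < s → l = b1 - a1 ∧ u = b1 - a1) := by
    intro s
    by_cases hs : s ≤ N
    · let D : Finset ℤ := (Finset.Icc 0 (b1 - a1)).filter fun x => (a1 + x, a2 + (s - x)) ∈ S
      have hD : ∀ x, x ∈ D ↔ (a1 + x, a2 + (s - x)) ∈ S := by
        intro x
        simp only [D, Finset.mem_filter, Finset.mem_Icc, and_iff_right_iff_imp]
        intro hm
        have := hlow hm
        have := hupp hm
        omega
      have hne : D.Nonempty := by
        obtain ⟨x, hx⟩ := hdiag s hs
        exact ⟨x, (hD x).2 hx⟩
      refine ⟨D.min' hne, D.max' hne, D.min'_le_max' hne, fun _ x => ⟨fun hx => ?_, fun hx => ?_⟩,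
        fun h' => by omega⟩
      · exact ⟨D.min'_le _ ((hD x).2 hx), D.le_max' _ ((hD x).2 hx)⟩
      -- No gaps: the extreme cells of an antidiagonal span an antirectangle containing all the
      -- cells between them.
      · exact h.mem_of_antirectangle ((hD _).1 (D.min'_mem hne)) ((hD _).1 (D.max'_mem hne))
          (by omega) (by omega) (by omega) (by omega)
    -- Beyond the last antidiagonal the ends are frozen, because `IsStair` imposes its step
    -- conditions for every `s`; `stairSet` ignores these values.
    · exact ⟨b1 - a1, b1 - a1, le_rfl, fun h' => absurd h' hs, fun _ => ⟨rfl, rfl⟩⟩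
  choose lo hi hle hmem hout using hex
  have hsingle : ∀ s : ℕ, s ≤ N → ∀ c : ℤ, (∀ x : ℤ, (a1 + x, a2 + (s - x)) ∈ S → x = c) →
      lo s = c ∧ hi s = c := by
    intro s hs c hc
    exact ⟨hc _ ((hmem s hs _).2 ⟨le_rfl, hle s⟩), hc _ ((hmem s hs _).2 ⟨hle s, le_rfl⟩)⟩
  have h0 := hsingle 0 (Nat.zero_le _) 0 (fun x hx => by have := hlow hx; push_cast at this; omega)
  have hNN := hsingle N le_rfl (b1 - a1) (fun x hx => by have := hupp hx; omega)
  have hsucc : ∀ s, s < N → ∀ x, lo s ≤ x → x ≤ hi s →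
      (lo (s + 1) ≤ x + 1 ∧ x + 1 ≤ hi (s + 1)) ∨ (lo (s + 1) ≤ x ∧ x ≤ hi (s + 1)) := by
    intro s hs x hx1 hx2
    have hx := (hmem s hs.le x).2 ⟨hx1, hx2⟩
    rcases h.exists_succ hb hx (by simp only [ne_eq, Prod.mk.injEq]; omega) with h' | h'
    · left; rw [← hmem (s + 1) hs]; convert h' using 2 <;> push_cast <;> ring
    · right; rw [← hmem (s + 1) hs]; convert h' using 2; push_cast; ring
  have hpred : ∀ s, s < N → ∀ x, lo (s + 1) ≤ x → x ≤ hi (s + 1) →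
      (lo s ≤ x - 1 ∧ x - 1 ≤ hi s) ∨ (lo s ≤ x ∧ x ≤ hi s) := by
    intro s hs x hx1 hx2
    have hx := (hmem (s + 1) hs x).2 ⟨hx1, hx2⟩
    rcases h.exists_pred ha hx (by simp only [ne_eq, Prod.mk.injEq]; omega) with h' | h'
    · left; rw [← hmem s hs.le]; convert h' using 2 <;> push_cast <;> ring
    · right; rw [← hmem s hs.le]; convert h' using 2; push_cast; ring
  -- Successors of the extreme cells of slice `s` give `lo (s + 1) ≤ lo s + 1` and `hi s ≤ hi (s +
  -- 1)`; predecessors of those of slice `s + 1` give the other two inequalities.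
  have hsteps : ∀ s, (lo s ≤ lo (s + 1) ∧ lo (s + 1) ≤ lo s + 1) ∧
      (hi s ≤ hi (s + 1) ∧ hi (s + 1) ≤ hi s + 1) := by
    intro s
    rcases lt_trichotomy s N with hs | rfl | hs
    · have e1 := hsucc s hs _ le_rfl (hle s)
      have e2 := hsucc s hs _ (hle s) le_rfl
      have e3 := hpred s hs _ le_rfl (hle (s + 1))
      have e4 := hpred s hs _ (hle (s + 1)) le_rfl
      omega
    · have := hout (s + 1) (by omega)
      omega
    · have := hout (s + 1) (by omega)
      have := hout s (by omega)
      omega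
  refine ⟨N, lo, hi, ⟨h0.1, h0.2, fun s => (hsteps s).1.1, fun s => (hsteps s).1.2,
    fun s => (hsteps s).2.1, fun s => (hsteps s).2.2, hle, hNN.1.trans hNN.2.symm⟩,
    Quotient.sound ⟨(a1, a2), ?_⟩⟩
  ext ⟨x, y⟩
  rw [mem_translateCells, mem_stairSet]
  simp only [Prod.fst_add, Prod.snd_add, Prod.fst_neg, Prod.snd_neg]
  constructor
  · rintro ⟨s, hs, h1, h2⟩
    have := (hmem s hs _).2 h2
    convert this using 2
    · ring
    · omega
  · intro hm
    have h1 := hlow hm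
    have h2 := hupp hm
    refine ⟨(-a1 + x + (-a2 + y)).toNat, by omega, by omega, ?_⟩
    rw [← hmem _ (by omega)]
    convert hm using 2
    · ring
    · omega

theorem card_stairSet {N : ℕ} {lo hi : ℕ → ℤ} (h : ∀ s, lo s ≤ hi s) :
    ((stairSet N lo hi).card : ℤ) = ∑ s ∈ Finset.range (N + 1), (hi s - lo s + 1) := by
  rw [stairSet, Finset.card_biUnion]
  · push_cast
    refine Finset.sum_congr rfl fun s _ => ?_
    rw [Finset.card_image_of_injective, Int.card_Icc]
    · have := h s
      omega
    · intro x y hxy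
      simpa using congrArg Prod.fst hxy
  · intro s _ t _ hst
    rw [Function.onFun, Finset.disjoint_left]
    simp only [Finset.mem_image, not_exists, not_and]
    rintro _ ⟨x, -, rfl⟩ y - hxy
    simp only [Prod.mk.injEq] at hxy
    omega

/-! ### Every stair is a parallelogram polyomino; its size parameters. -/

namespace IsStair

variable {N : ℕ} {lo hi : ℕ → ℤ}

theorem lo_mono (h : IsStair N lo hi) : Monotone lo := monotone_nat_of_le_succ h.lo_le_succ

theorem hi_mono (h : IsStair N lo hi) : Monotone hi := monotone_nat_of_le_succ h.hi_le_succ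

/-- Up to sign, `lo s - s` is the row of an end cell; its monotonicity serves rows as that of `lo`
serves columns. -/
theorem lo_sub_antitone (h : IsStair N lo hi) : Antitone fun s => lo s - s :=
  antitone_nat_of_succ_le fun s => by have := h.lo_succ_le s; push_cast; omega

theorem hi_sub_antitone (h : IsStair N lo hi) : Antitone fun s => hi s - s :=
  antitone_nat_of_succ_le fun s => by have := h.hi_succ_le s; push_cast; omega

theorem lo_nonneg (h : IsStair N lo hi) (s : ℕ) : 0 ≤ lo s :=
  h.lo_zero ▸ h.lo_mono (Nat.zero_le s)

theorem hi_le (h : IsStair N lo hi) (s : ℕ) : hi s ≤ s := by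
  have := h.hi_sub_antitone (Nat.zero_le s)
  simp only [h.hi_zero] at this
  push_cast at this
  omega

theorem zero_mem (h : IsStair N lo hi) : (0 : Cell) ∈ stairSet N lo hi :=
  (mem_stairSet_of_add_eq (s := 0) (by simp)).2 ⟨Nat.zero_le _, h.lo_zero.le, h.hi_zero.ge⟩

theorem isLeast (h : IsStair N lo hi) : IsLeast (stairSet N lo hi : Set Cell) 0 := by
  refine ⟨h.zero_mem, ?_⟩
  rintro ⟨x, y⟩ hp
  obtain ⟨s, hs, h1, h2, h3⟩ := mem_stairSet.1 hp
  have := h.lo_nonneg s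
  have := h.hi_le s
  simp only at h1 h2 h3
  exact ⟨by simp only [Prod.fst_zero]; omega, by simp only [Prod.snd_zero]; omega⟩

theorem last_mem (h : IsStair N lo hi) : ((lo N, N - lo N) : Cell) ∈ stairSet N lo hi :=
  (mem_stairSet_of_add_eq (s := N) (by ring)).2 ⟨le_rfl, le_rfl, h.last.le⟩

theorem isGreatest (h : IsStair N lo hi) :
    IsGreatest (stairSet N lo hi : Set Cell) (lo N, N - lo N) := by
  refine ⟨h.last_mem, ?_⟩
  rintro ⟨x, y⟩ hp
  obtain ⟨s, hs, h1, h2, h3⟩ := mem_stairSet.1 hp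
  have e1 := h.hi_mono hs
  have e2 := h.lo_sub_antitone hs
  have := h.last
  simp only at h1 h2 h3 e2
  exact ⟨by simp only; omega, by simp only; omega⟩

theorem exists_pred (h : IsStair N lo hi) {s : ℕ} {x : ℤ}
    (h1 : lo (s + 1) ≤ x) (h2 : x ≤ hi (s + 1)) :
    (lo s ≤ x - 1 ∧ x - 1 ≤ hi s) ∨ (lo s ≤ x ∧ x ≤ hi s) := by
  have := h.lo_le_succ s
  have := h.hi_succ_le s
  have := h.lo_le_hi s
  omega

theorem isPolyomino (h : IsStair N lo hi) : IsPolyomino (stairSet N lo hi) := by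
  have hreach : ∀ s : ℕ, ∀ x y : ℤ, x + y = s → ∀ hm : (x, y) ∈ stairSet N lo hi,
      (cellGraph.induce (stairSet N lo hi : Set Cell)).Reachable ⟨0, h.zero_mem⟩ ⟨(x, y), hm⟩ := by
    intro s
    induction s with
    | zero =>
      intro x y hxy hm
      have h0 : (0 : Cell) ≤ (x, y) := h.isLeast.2 hm
      have h1 : 0 ≤ x ∧ 0 ≤ y := h0
      obtain ⟨rfl, rfl⟩ : x = 0 ∧ y = 0 := by push_cast at hxy; omega
      exact SimpleGraph.Reachable.refl _
    | succ s ih =>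
      intro x y hxy hm
      obtain ⟨hs, h1, h2⟩ := (mem_stairSet_of_add_eq hxy).1 hm
      rcases h.exists_pred h1 h2 with h' | h'
      · have hm' := (mem_stairSet_of_add_eq (N := N) (s := s) (x := x - 1) (y := y)
          (by push_cast at hxy; omega)).2 ⟨by omega, h'⟩
        refine (ih _ _ (by push_cast at hxy; omega) hm').trans (SimpleGraph.Adj.reachable ?_)
        exact Or.inr ⟨rfl, by simp⟩
      · have hm' := (mem_stairSet_of_add_eq (N := N) (s := s) (x := x) (y := y - 1)
          (by push_cast at hxy; omega)).2 ⟨by omega, h'⟩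
        refine (ih _ _ (by push_cast at hxy; omega) hm').trans (SimpleGraph.Adj.reachable ?_)
        exact Or.inl ⟨rfl, by simp⟩
  rw [IsPolyomino, SimpleGraph.connected_iff_exists_forall_reachable]
  refine ⟨⟨0, h.zero_mem⟩, ?_⟩
  rintro ⟨⟨x, y⟩, hm⟩
  obtain ⟨s, -, h1, -⟩ := mem_stairSet.1 hm
  exact hreach s x y h1 hm

theorem isParallelogramPolyomino (h : IsStair N lo hi) :
    IsParallelogramPolyomino (stairSet N lo hi) where
  isPolyomino := h.isPolyomino
  verticallyConvex := by
    intro x y₁ y y₂ h₁ h₂ hy₁ hy₂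
    obtain ⟨s₁, hs₁, e₁, l₁, u₁⟩ := mem_stairSet.1 h₁
    obtain ⟨s₂, hs₂, e₂, l₂, u₂⟩ := mem_stairSet.1 h₂
    simp only at *
    obtain ⟨s, hs⟩ : ∃ s : ℕ, x + y = s := ⟨(x + y).toNat, by omega⟩
    have := h.lo_mono (show s ≤ s₂ by omega)
    have := h.hi_mono (show s₁ ≤ s by omega)
    exact (mem_stairSet_of_add_eq hs).2 ⟨by omega, by omega, by omega⟩
  horizontallyConvex := by
    intro x₁ x x₂ y h₁ h₂ hx₁ hx₂
    obtain ⟨s₁, hs₁, e₁, l₁, u₁⟩ := mem_stairSet.1 h₁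
    obtain ⟨s₂, hs₂, e₂, l₂, u₂⟩ := mem_stairSet.1 h₂
    simp only at *
    obtain ⟨s, hs⟩ : ∃ s : ℕ, x + y = s := ⟨(x + y).toNat, by omega⟩
    have := h.lo_sub_antitone (show s₁ ≤ s by omega)
    have := h.hi_sub_antitone (show s ≤ s₂ by omega)
    simp only at *
    exact (mem_stairSet_of_add_eq hs).2 ⟨by omega, by omega, by omega⟩
  bottomLeft := ⟨_, h.isLeast⟩
  topRight := ⟨_, h.isGreatest⟩

/-- Stair sets are determined by their translation class. -/
theorem stairSet_eq_of_mk_eq {N' : ℕ} {lo' hi' : ℕ → ℤ} (h : IsStair N lo hi)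
    (h' : IsStair N' lo' hi')
    (e : (⟦stairSet N lo hi⟧ : TranslationClass) = ⟦stairSet N' lo' hi'⟧) :
    stairSet N lo hi = stairSet N' lo' hi' := by
  -- Both sets have least cell `0`, so the translation vector satisfies `0 ≤ v` and `0 ≤ -v`.
  obtain ⟨v, hv⟩ := Quotient.exact e
  have h1 : v ∈ stairSet N' lo' hi' := by
    rw [← hv, mem_translateCells]; simpa using h.zero_mem
  have h2 : -v ∈ stairSet N lo hi := by
    have := h'.zero_mem
    rw [← hv, mem_translateCells] at this; simpa using this
  have h3 : (0 : Cell) ≤ v := h'.isLeast.2 h1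
  have h4 : (0 : Cell) ≤ -v := h.isLeast.2 h2
  have hv0 : v = 0 := le_antisymm (by simpa using h4) h3
  rw [← hv, hv0]
  ext a
  simp [mem_translateCells]

theorem ends_eq {N' : ℕ} {lo' hi' : ℕ → ℤ} (h : IsStair N lo hi) (h' : IsStair N' lo' hi')
    (e : stairSet N lo hi = stairSet N' lo' hi') {s : ℕ} (hs : s ≤ N) :
    lo s = lo' s ∧ hi s = hi' s := by
  have hm : ∀ x : ℤ, (lo s ≤ x ∧ x ≤ hi s) → (lo' s ≤ x ∧ x ≤ hi' s) ∧ s ≤ N' := by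
    intro x hx
    have := (mem_stairSet_of_add_eq (N := N) (s := s) (x := x) (y := s - x) (by ring)).2 ⟨hs, hx⟩
    rw [e, mem_stairSet_of_add_eq (s := s) (by ring)] at this
    exact ⟨this.2, this.1⟩
  have hm' : ∀ x : ℤ, (lo' s ≤ x ∧ x ≤ hi' s) → s ≤ N' → (lo s ≤ x ∧ x ≤ hi s) := by
    intro x hx hs'
    have := (mem_stairSet_of_add_eq (N := N') (s := s) (x := x) (y := s - x) (by ring)).2 ⟨hs', hx⟩
    rw [← e, mem_stairSet_of_add_eq (s := s) (by ring)] at this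
    exact this.2
  have h1 := hm _ ⟨le_rfl, h.lo_le_hi s⟩
  have h2 := hm _ ⟨h.lo_le_hi s, le_rfl⟩
  have h3 := hm' _ ⟨le_rfl, h'.lo_le_hi s⟩ h1.2
  have h4 := hm' _ ⟨h'.lo_le_hi s, le_rfl⟩ h1.2
  omega

/-- A discrete intermediate value property: with unit steps, the end cells alone already meet every
column of the bounding rectangle, which gives its width. -/
theorem exists_mem_diagonal (h : IsStair N lo hi) {x : ℤ} (h0 : 0 ≤ x) (hx : x ≤ lo N) :
    ∃ s ≤ N, lo s = x := by
  have key : ∀ n : ℕ, ∀ x : ℤ, 0 ≤ x → x ≤ lo n → ∃ s ≤ n, lo s = x := by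
    intro n
    induction n with
    | zero => intro x h0 hx; exact ⟨0, le_rfl, by have := h.lo_zero; omega⟩
    | succ n ih =>
      intro x h0 hx
      rcases le_or_gt x (lo n) with hx' | hx'
      · obtain ⟨s, hs, e⟩ := ih x h0 hx'
        exact ⟨s, by omega, e⟩
      · exact ⟨n + 1, le_rfl, by have := h.lo_succ_le n; omega⟩
  exact key N x h0 hx

theorem exists_mem_diagonal' (h : IsStair N lo hi) {y : ℤ} (h0 : 0 ≤ y) (hy : y ≤ N - lo N) :
    ∃ s ≤ N, s - lo s = y := by
  have key : ∀ n : ℕ, ∀ x : ℤ, 0 ≤ x → x ≤ n - lo n → ∃ s ≤ n, s - lo s = x := by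
    intro n
    induction n with
    | zero => intro x h0 hx; exact ⟨0, le_rfl, by have := h.lo_zero; push_cast at *; omega⟩
    | succ n ih =>
      intro x h0 hx
      rcases le_or_gt x (n - lo n) with hx' | hx'
      · obtain ⟨s, hs, e⟩ := ih x h0 hx'
        exact ⟨s, by omega, e⟩
      · exact ⟨n + 1, le_rfl, by have := h.lo_le_succ n; push_cast at *; omega⟩
  exact key N y h0 hy

theorem width_add_height (h : IsStair N lo hi) :
    width (stairSet N lo hi) + height (stairSet N lo hi) = N + 2 := by
  have hlast := h.isGreatest
  have hl0 := h.lo_nonneg N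
  have hlN := (h.lo_le_hi N).trans (h.hi_le N)
  have hw : (stairSet N lo hi).image Prod.fst = Finset.Icc 0 (lo N) := by
    ext x
    rw [Finset.mem_image, Finset.mem_Icc]
    constructor
    · rintro ⟨p, hp, rfl⟩
      exact ⟨(h.isLeast.2 hp).1, (h.isGreatest.2 hp).1⟩
    · rintro ⟨h0, hx⟩
      obtain ⟨s, hs, rfl⟩ := h.exists_mem_diagonal h0 hx
      exact ⟨(lo s, s - lo s),
        (mem_stairSet_of_add_eq (s := s) (by ring)).2 ⟨hs, le_rfl, h.lo_le_hi s⟩, rfl⟩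
  have hh : (stairSet N lo hi).image Prod.snd = Finset.Icc 0 (N - lo N) := by
    ext x
    rw [Finset.mem_image, Finset.mem_Icc]
    constructor
    · rintro ⟨p, hp, rfl⟩
      exact ⟨(h.isLeast.2 hp).2, (h.isGreatest.2 hp).2⟩
    · rintro ⟨h0, hx⟩
      obtain ⟨s, hs, rfl⟩ := h.exists_mem_diagonal' h0 hx
      exact ⟨(lo s, s - lo s),
        (mem_stairSet_of_add_eq (s := s) (by ring)).2 ⟨hs, le_rfl, h.lo_le_hi s⟩, rfl⟩
  rw [width, height, hw, hh, Int.card_Icc, Int.card_Icc]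
  omega

theorem lt_card (h : IsStair N lo hi) : N + 1 ≤ (stairSet N lo hi).card := by
  have h1 := card_stairSet (N := N) h.lo_le_hi
  have h2 : ∑ s ∈ Finset.range (N + 1), (1 : ℤ) ≤
      ∑ s ∈ Finset.range (N + 1), (hi s - lo s + 1) :=
    Finset.sum_le_sum fun s _ => by have := h.lo_le_hi s; omega
  rw [Finset.sum_const, Finset.card_range, ← h1] at h2
  simp only [nsmul_eq_mul, mul_one] at h2
  exact_mod_cast h2

end IsStair

/-! ### Finiteness of the sets being counted. -/

namespace TranslationClass

theorem isParallelogram_iff {c : TranslationClass} :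
    c.IsParallelogram ↔ ∃ N lo hi, IsStair N lo hi ∧ ⟦stairSet N lo hi⟧ = c := by
  constructor
  · rintro ⟨S, hS, rfl⟩
    exact hS.exists_stair
  · rintro ⟨N, lo, hi, h, rfl⟩
    exact ⟨_, h.isParallelogramPolyomino, rfl⟩

theorem area_mk (S : Finset Cell) : area ⟦S⟧ = S.card := rfl

theorem halfPerimeter_mk (S : Finset Cell) : halfPerimeter ⟦S⟧ = width S + height S := rfl

/-- The classes coming from stairs with boundedly many antidiagonals are finite in number. -/
theorem finite_of_forall_exists_stair {X : Set TranslationClass} (n : ℕ)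
    (h : ∀ c ∈ X, ∃ N ≤ n, ∃ lo hi, IsStair N lo hi ∧ ⟦stairSet N lo hi⟧ = c) : X.Finite := by
  refine Set.Finite.subset ((Finset.finite_toSet
    (Finset.Icc (0 : Cell) (n, n)).powerset).image fun S => (⟦S⟧ : TranslationClass)) ?_
  intro c hc
  obtain ⟨N, hN, lo, hi, hs, rfl⟩ := h c hc
  refine ⟨_, ?_, rfl⟩
  simp only [Finset.coe_powerset, Set.mem_preimage, Set.mem_powerset_iff]
  intro p hp
  rw [Finset.mem_coe, Finset.mem_Icc]
  refine ⟨hs.isLeast.2 hp, (hs.isGreatest.2 hp).trans ⟨?_, ?_⟩⟩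
  · have := (hs.lo_le_hi N).trans (hs.hi_le N)
    simp only; omega
  · have := hs.lo_nonneg N
    simp only; omega

theorem finite_isParallelogram_area (n : ℕ) :
    {c : TranslationClass | c.IsParallelogram ∧ c.area = n}.Finite := by
  refine finite_of_forall_exists_stair n ?_
  rintro c ⟨hc, ha⟩
  obtain ⟨N, lo, hi, h, rfl⟩ := isParallelogram_iff.1 hc
  have := h.lt_card
  rw [area_mk] at ha
  exact ⟨N, by omega, lo, hi, h, rfl⟩

theorem finite_isParallelogram_halfPerimeter (n : ℕ) :
    {c : TranslationClass | c.IsParallelogram ∧ c.halfPerimeter = n}.Finite := by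
  refine finite_of_forall_exists_stair n ?_
  rintro c ⟨hc, ha⟩
  obtain ⟨N, lo, hi, h, rfl⟩ := isParallelogram_iff.1 hc
  have := h.width_add_height
  rw [halfPerimeter_mk] at ha
  exact ⟨N, by omega, lo, hi, h, rfl⟩

end TranslationClass

/-! ### Lower bounds from thin polyominoes. -/

/-- Here `c s` is `lo s + hi s`: halving it with both roundings gives slices of length at most two,
of length one exactly when `c s` is even. Hence the parity condition at the last slice. -/
theorem isStair_half {N : ℕ} {c : ℕ → ℕ} (h0 : c 0 = 0) (h1 : ∀ s, c s ≤ c (s + 1))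
    (h2 : ∀ s, c (s + 1) ≤ c s + 2) (hN : c N % 2 = 0) :
    IsStair N (fun s => ((c s / 2 : ℕ) : ℤ)) (fun s => (((c s + 1) / 2 : ℕ) : ℤ)) where
  lo_zero := by simp [h0]
  hi_zero := by simp [h0]
  lo_le_succ s := by have := h1 s; omega
  lo_succ_le s := by have := h2 s; omega
  hi_le_succ s := by have := h1 s; omega
  hi_succ_le s := by have := h2 s; omega
  lo_le_hi s := by omega
  last := by omega

/-- The `i`-th letter of a word of length `m`, and `0` beyond the end of the word. -/
def letterAt {m : ℕ} (v : Fin m → Fin 3) (i : ℕ) : ℕ := if h : i < m then v ⟨i, h⟩ else 0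

/-- The sum of the first `s` letters of a word of length `m`, made even after the last one. -/
def evenedSum {m : ℕ} (v : Fin m → Fin 3) (s : ℕ) : ℕ :=
  (∑ i ∈ Finset.range s, letterAt v i) +
    if m < s then (∑ i ∈ Finset.range m, letterAt v i) % 2 else 0

section

variable {m : ℕ} (v : Fin m → Fin 3)

theorem letterAt_le (i : ℕ) : letterAt v i ≤ 2 := by
  rw [letterAt]; split_ifs <;> omega

theorem letterAt_of_le {i : ℕ} (h : m ≤ i) : letterAt v i = 0 := by
  rw [letterAt, dif_neg (by omega)]

theorem evenedSum_zero : evenedSum v 0 = 0 := by simp [evenedSum]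

theorem evenedSum_of_le {s : ℕ} (h : s ≤ m) :
    evenedSum v s = ∑ i ∈ Finset.range s, letterAt v i := by
  rw [evenedSum, if_neg (by omega), add_zero]

theorem evenedSum_succ_of_lt {s : ℕ} (h : s < m) :
    evenedSum v (s + 1) = evenedSum v s + letterAt v s := by
  rw [evenedSum_of_le v h, evenedSum_of_le v h.le, Finset.sum_range_succ]

theorem evenedSum_succ_self : evenedSum v (m + 1) = evenedSum v m + evenedSum v m % 2 := by
  rw [evenedSum_of_le v le_rfl, evenedSum, if_pos (by omega), Finset.sum_range_succ,
    letterAt_of_le v le_rfl, add_zero]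

theorem evenedSum_succ_of_gt {s : ℕ} (h : m < s) : evenedSum v (s + 1) = evenedSum v s := by
  rw [evenedSum, evenedSum, if_pos (by omega), if_pos h, Finset.sum_range_succ,
    letterAt_of_le v h.le, add_zero]

theorem isStair_evenedSum : IsStair (m + 1) (fun s => ((evenedSum v s / 2 : ℕ) : ℤ))
    (fun s => (((evenedSum v s + 1) / 2 : ℕ) : ℤ)) := by
  have key : ∀ s, evenedSum v s ≤ evenedSum v (s + 1) ∧
      evenedSum v (s + 1) ≤ evenedSum v s + 2 := by
    intro s
    rcases lt_trichotomy s m with h | rfl | h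
    · have := evenedSum_succ_of_lt v h
      have := letterAt_le v s
      omega
    · have := evenedSum_succ_self v
      omega
    · have := evenedSum_succ_of_gt v h
      omega
  exact isStair_half (evenedSum_zero v) (fun s => (key s).1) (fun s => (key s).2)
    (by rw [evenedSum_succ_self]; omega)

/-- The parallelogram polyomino with diagonals of length at most two coded by a ternary word. -/
noncomputable def wordClass : TranslationClass :=
  ⟦stairSet (m + 1) (fun s => ((evenedSum v s / 2 : ℕ) : ℤ))
    (fun s => (((evenedSum v s + 1) / 2 : ℕ) : ℤ))⟧

theorem isParallelogram_wordClass : (wordClass v).IsParallelogram :=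
  ⟨_, (isStair_evenedSum v).isParallelogramPolyomino, rfl⟩

theorem halfPerimeter_wordClass : (wordClass v).halfPerimeter = m + 3 :=
  (isStair_evenedSum v).width_add_height

theorem area_wordClass (hv : ∀ i, (v i : ℕ) % 2 = 0) : (wordClass v).area = m + 2 := by
  have hl : ∀ i, letterAt v i % 2 = 0 := by
    intro i; rw [letterAt]; split_ifs
    · exact hv _
    · rfl
  have hs : ∀ s, s ≤ m + 1 → evenedSum v s % 2 = 0 := by
    intro s
    induction s with
    | zero => intro _; rw [evenedSum_zero]
    | succ s ih =>
      intro h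
      have := ih (by omega)
      rcases (show s ≤ m by omega).lt_or_eq with h' | rfl
      · rw [evenedSum_succ_of_lt v h']; have := hl s; omega
      · rw [evenedSum_succ_self]; omega
  have h := card_stairSet (N := m + 1) (isStair_evenedSum v).lo_le_hi
  rw [Finset.sum_congr rfl (g := fun _ => (1 : ℤ))] at h
  · rw [Finset.sum_const, Finset.card_range, nsmul_eq_mul, mul_one] at h
    rw [wordClass, TranslationClass.area_mk]
    exact_mod_cast h
  · intro s hs'
    have := hs s (by rw [Finset.mem_range] at hs'; omega)
    omega

end

/-- The two ends add up to `evenedSum`, whose successive differences are the letters. -/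
theorem wordClass_injective (m : ℕ) :
    Function.Injective (wordClass : (Fin m → Fin 3) → TranslationClass) := by
  intro v w h
  have e := (isStair_evenedSum v).stairSet_eq_of_mk_eq (isStair_evenedSum w) h
  have hs : ∀ s ≤ m + 1, evenedSum v s = evenedSum w s := by
    intro s hs
    have := (isStair_evenedSum v).ends_eq (isStair_evenedSum w) e hs
    omega
  ext i
  have h1 := evenedSum_succ_of_lt v i.2
  have h2 := evenedSum_succ_of_lt w i.2
  rw [hs _ (by omega), hs _ (by omega), h2] at h1
  simpa [letterAt] using h1.symm

theorem pow_le_countByHalfPerimeter (m : ℕ) : 3 ^ m ≤ countByHalfPerimeter (m + 3) := by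
  have h := Set.ncard_le_ncard (s := Set.range (wordClass : (Fin m → Fin 3) → TranslationClass))
    (by rintro _ ⟨v, rfl⟩; exact ⟨isParallelogram_wordClass v, halfPerimeter_wordClass v⟩)
    (TranslationClass.finite_isParallelogram_halfPerimeter (m + 3))
  rw [← Nat.card_coe_set_eq, Nat.card_range_of_injective (wordClass_injective m)] at h
  simpa [countByHalfPerimeter] using h

theorem pow_le_countByArea (m : ℕ) : 2 ^ m ≤ countByArea (m + 2) := by
  -- With letters `0` and `2` all partial sums are even, so every slice is a single cell and the
  -- area is the number `m + 2` of slices.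
  let f : (Fin m → Bool) → TranslationClass := fun b => wordClass fun i => if b i then 2 else 0
  have hf : Function.Injective f := by
    intro b c h
    have := wordClass_injective m h
    ext i
    have hi := congrFun this i
    cases hb : b i <;> cases hc : c i <;> simp_all
  have h := Set.ncard_le_ncard (s := Set.range f) (by
      rintro _ ⟨b, rfl⟩
      exact ⟨isParallelogram_wordClass _, area_wordClass _ fun i => by split_ifs <;> simp⟩)
    (TranslationClass.finite_isParallelogram_area (m + 2))
  rw [← Nat.card_coe_set_eq, Nat.card_range_of_injective hf] at h
  simpa [countByArea] using h

/-! ### Counting step words. -/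

/-- `AdmissibleWord T ℓ A w`: the letters of `w`, taken from `T`, are successive steps (of the lower
and the upper end) along diagonals of positive length, starting from length `ℓ`, and the lengths of
all these diagonals except the last one add up to at most `A`. -/
def AdmissibleWord (T : Finset (Bool × Bool)) : ℕ → ℕ → List (Bool × Bool) → Prop
  | _, _, [] => True
  | ℓ, A, t :: w => t ∈ T ∧ ℓ ≤ A ∧ 1 ≤ ℓ + t.2.toNat - t.1.toNat ∧
      AdmissibleWord T (ℓ + t.2.toNat - t.1.toNat) (A - ℓ) w

/-- Induction on the area: a nonempty word spends `ℓ` and leaves a shorter problem with budget `A -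
ℓ`. The `+ 1` strengthens the bound so that the empty word is absorbed at each stage. The numerical
hypotheses are what the cases `ℓ = 1` (`h3`, `h4`) and `ℓ ≥ 2` (`h2`, `h5`) need. -/
theorem exists_finset_admissibleWord {T : Finset (Bool × Bool)} (hT : (true, false) ∈ T) {c : ℝ}
    (hc : 1 ≤ c) (h2 : 2 ≤ (T.card : ℝ)) (h3 : (T.card : ℝ) ≤ c + 1)
    (h4 : 1 + (T.card : ℝ) ≤ 2 * c) (h5 : (T.card : ℝ) ≤ c ^ 2) (A : ℕ) :
    ∀ ℓ, 1 ≤ ℓ → ∃ F : Finset (List (Bool × Bool)),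
      (∀ w, AdmissibleWord T ℓ A w → w ∈ F) ∧ (F.card : ℝ) + 1 ≤ 2 * c ^ A := by
  induction A using Nat.strong_induction_on with
  | _ A ih =>
    intro ℓ hℓ
    rcases lt_or_ge A ℓ with hA | hA
    · refine ⟨{[]}, fun w hw => ?_, ?_⟩
      · cases w with
        | nil => simp
        | cons t w => exact absurd hw.2.1 (by omega)
      · have := one_le_pow₀ hc (n := A)
        rw [Finset.card_singleton]; push_cast; linarith
    · let T' := T.filter fun t => 1 ≤ ℓ + t.2.toNat - t.1.toNat
      have hF : ∀ t : Bool × Bool, ∃ F : Finset (List (Bool × Bool)),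
          t ∈ T' → (∀ w, AdmissibleWord T (ℓ + t.2.toNat - t.1.toNat) (A - ℓ) w → w ∈ F) ∧
            (F.card : ℝ) + 1 ≤ 2 * c ^ (A - ℓ) := by
        intro t
        by_cases ht : t ∈ T'
        · obtain ⟨F, hF⟩ := ih (A - ℓ) (by omega) _ (Finset.mem_filter.1 ht).2
          exact ⟨F, fun _ => hF⟩
        · exact ⟨∅, fun h => absurd h ht⟩
      choose F hF using hF
      refine ⟨insert [] (T'.biUnion fun t => (F t).image (List.cons t)), fun w hw => ?_, ?_⟩
      · cases w with
        | nil => simp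
        | cons t w =>
          have ht : t ∈ T' := Finset.mem_filter.2 ⟨hw.1, hw.2.2.1⟩
          exact Finset.mem_insert_of_mem (Finset.mem_biUnion.2
            ⟨t, ht, Finset.mem_image_of_mem _ ((hF t ht).1 w hw.2.2.2)⟩)
      · have hcard : ((T'.biUnion fun t => (F t).image (List.cons t)).card : ℝ) ≤
            T'.card * (2 * c ^ (A - ℓ) - 1) := by
          rw [← nsmul_eq_mul, ← Finset.sum_const]
          refine (Nat.cast_le.2 Finset.card_biUnion_le).trans ?_
          push_cast
          refine Finset.sum_le_sum fun t ht => ?_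
          have e1 : (((F t).image (List.cons t)).card : ℝ) ≤ (F t).card :=
            Nat.cast_le.2 Finset.card_image_le
          have e2 := (hF t ht).2
          linarith
        have hins : ((insert [] (T'.biUnion fun t => (F t).image (List.cons t))).card : ℝ) ≤
            (T'.biUnion fun t => (F t).image (List.cons t)).card + 1 := by
          exact_mod_cast Finset.card_insert_le _ _
        suffices (T'.card : ℝ) * (2 * c ^ (A - ℓ) - 1) + 2 ≤ 2 * c ^ A by linarith
        have hpow := one_le_pow₀ hc (n := A - ℓ)
        -- From length one the step `(true, false)` would empty the next diagonal, so one letter is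
        -- lost for one unit of area; a longer diagonal allows all letters but costs at least two
        -- units.
        rcases hℓ.eq_or_lt with rfl | hℓ'
        · have hT' : (T'.card : ℝ) ≤ T.card - 1 := by
            have : T' ⊆ T.erase (true, false) := by
              intro t ht
              refine Finset.mem_erase.2 ⟨?_, (Finset.mem_filter.1 ht).1⟩
              rintro rfl
              simp [T'] at ht
            have := Finset.card_le_card this
            rw [Finset.card_erase_of_mem hT] at this
            have h0 : 0 < T.card := Finset.card_pos.2 ⟨_, hT⟩
            rw [le_sub_iff_add_le]
            exact_mod_cast (by omega : T'.card + 1 ≤ T.card)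
          have hA' : c ^ A = c * c ^ (A - 1) := by rw [← pow_succ']; congr 1; omega
          rw [hA']
          have := mul_le_mul_of_nonneg_right hT' (by linarith : 0 ≤ 2 * c ^ (A - 1) - 1)
          nlinarith
        · have hT' : (T'.card : ℝ) ≤ T.card := Nat.cast_le.2 (Finset.card_filter_le _ _)
          have hA' : c ^ 2 * c ^ (A - ℓ) ≤ c ^ A := by
            rw [← pow_add]; exact pow_le_pow_right₀ hc (by omega)
          have e1 := mul_le_mul_of_nonneg_right hT' (by linarith : 0 ≤ 2 * c ^ (A - ℓ) - 1)
          have e2 := mul_le_mul_of_nonneg_right h5 (by linarith : 0 ≤ c ^ (A - ℓ))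
          nlinarith

theorem exists_finset_words (T : Finset (Bool × Bool)) (K : ℕ) :
    ∃ F : Finset (List (Bool × Bool)),
      (∀ w, w.length = K → (∀ t ∈ w, t ∈ T) → w ∈ F) ∧ F.card ≤ T.card ^ K := by
  induction K with
  | zero => exact ⟨{[]}, fun w hw _ => by simpa using hw, by simp⟩
  | succ K ih =>
    obtain ⟨F, hF, hcard⟩ := ih
    refine ⟨(T ×ˢ F).image fun x => x.1 :: x.2, fun w hw hT => ?_, ?_⟩
    · cases w with
      | nil => simp at hw
      | cons t w =>
        refine Finset.mem_image.2 ⟨(t, w), Finset.mem_product.2 ⟨hT t (by simp), hF w ?_ ?_⟩, rfl⟩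
        · simpa using hw
        · exact fun u hu => hT u (by simp [hu])
    · refine Finset.card_image_le.trans ?_
      rw [Finset.card_product, pow_succ']
      exact Nat.mul_le_mul_left _ hcard

/-- The steps of the ends of `k` consecutive diagonals, starting with diagonal `s`. -/
def stepWord (lo hi : ℕ → ℤ) : ℕ → ℕ → List (Bool × Bool)
  | _, 0 => []
  | s, k + 1 => (decide (lo s < lo (s + 1)), decide (hi s < hi (s + 1))) :: stepWord lo hi (s + 1) k

theorem length_stepWord (lo hi : ℕ → ℤ) (s k : ℕ) : (stepWord lo hi s k).length = k := by
  induction k generalizing s with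
  | zero => rfl
  | succ k ih => simp [stepWord, ih]

theorem mem_of_mem_stepWord {lo hi : ℕ → ℤ} {T : Finset (Bool × Bool)} {s k : ℕ}
    (h : ∀ i, s ≤ i → i < s + k → (decide (lo i < lo (i + 1)), decide (hi i < hi (i + 1))) ∈ T) :
    ∀ t ∈ stepWord lo hi s k, t ∈ T := by
  induction k generalizing s with
  | zero => simp [stepWord]
  | succ k ih =>
    intro t ht
    rw [stepWord, List.mem_cons] at ht
    rcases ht with rfl | ht
    · exact h s le_rfl (by omega)
    · exact ih (fun i h1 h2 => h i (by omega) (by omega)) t ht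

namespace IsStair

variable {N N' : ℕ} {lo hi lo' hi' : ℕ → ℤ}

theorem admissibleWord_stepWord (h : IsStair N lo hi) {T : Finset (Bool × Bool)} {s k A ℓ : ℕ}
    (hT : ∀ t ∈ stepWord lo hi s k, t ∈ T) (hℓ : (ℓ : ℤ) = hi s - lo s + 1)
    (hA : ∑ i ∈ Finset.range k, (hi (s + i) - lo (s + i) + 1) ≤ A) :
    AdmissibleWord T ℓ A (stepWord lo hi s k) := by
  induction k generalizing s A ℓ with
  | zero => trivial
  | succ k ih =>
    rw [stepWord] at hT ⊢
    rw [Finset.sum_range_succ'] at hA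
    have hnn : 0 ≤ ∑ i ∈ Finset.range k, (hi (s + (i + 1)) - lo (s + (i + 1)) + 1) :=
      Finset.sum_nonneg fun i _ => by have := h.lo_le_hi (s + (i + 1)); omega
    simp only [add_zero] at hA
    have h1 := h.lo_le_succ s
    have h2 := h.lo_succ_le s
    have h3 := h.hi_le_succ s
    have h4 := h.hi_succ_le s
    have h5 := h.lo_le_hi (s + 1)
    -- The natural subtraction is not truncated, because the next diagonal is nonempty.
    have hnext : ((ℓ + (decide (hi s < hi (s + 1))).toNat - (decide (lo s < lo (s + 1))).toNat : ℕ)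
        : ℤ) = hi (s + 1) - lo (s + 1) + 1 := by
      by_cases e1 : lo s < lo (s + 1) <;> by_cases e2 : hi s < hi (s + 1) <;> simp [e1, e2] <;> omega
    refine ⟨hT _ (by simp), by omega, by simp only; omega, ih (fun t ht => hT t (by simp [ht])) hnext ?_⟩
    have e : ∀ i, s + 1 + i = s + (i + 1) := fun i => by ring
    simp only [e]
    omega

theorem ends_eq_of_stepWord_eq (h : IsStair N lo hi) (h' : IsStair N' lo' hi') {K : ℕ}
    (e : stepWord lo hi 0 K = stepWord lo' hi' 0 K) {s : ℕ} (hs : s ≤ K) :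
    lo s = lo' s ∧ hi s = hi' s := by
  have key : ∀ k s, lo s = lo' s → hi s = hi' s → stepWord lo hi s k = stepWord lo' hi' s k →
      ∀ i ≤ k, lo (s + i) = lo' (s + i) ∧ hi (s + i) = hi' (s + i) := by
    intro k
    induction k with
    | zero =>
      intro s h1 h2 _ i hi0
      obtain rfl : i = 0 := by omega
      exact ⟨h1, h2⟩
    | succ k ih =>
      intro s h1 h2 hw i hik
      rw [stepWord, stepWord, List.cons.injEq, Prod.mk.injEq, decide_eq_decide,
        decide_eq_decide] at hw
      cases i with
      | zero => exact ⟨h1, h2⟩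
      | succ i =>
        have := ih (s + 1) (by
          have := h.lo_le_succ s; have := h.lo_succ_le s
          have := h'.lo_le_succ s; have := h'.lo_succ_le s; omega) (by
          have := h.hi_le_succ s; have := h.hi_succ_le s
          have := h'.hi_le_succ s; have := h'.hi_succ_le s; omega) hw.2 i (by omega)
        rwa [show s + 1 + i = s + (i + 1) by ring] at this
  have := key K 0 (h.lo_zero.trans h'.lo_zero.symm) (h.hi_zero.trans h'.hi_zero.symm) e s hs
  simpa using this

end IsStair

/-! ### From step words to classes. -/

/-- A class is sent injectively to its top-right cell, one of `(n + 1) ^ 2`, and its first `K N`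
steps. `Q` stands for whatever symmetry lets these data determine the remaining slices. -/
theorem ncard_le_of_stepWord {X : Set TranslationClass} {n : ℕ} {F : Finset (List (Bool × Bool))}
    (Q : ℕ → (ℕ → ℤ) → (ℕ → ℤ) → Prop) (K : ℕ → ℕ)
    (hX : ∀ c ∈ X, ∃ N lo hi, IsStair N lo hi ∧ ⟦stairSet N lo hi⟧ = c ∧ Q N lo hi ∧ N ≤ n ∧
      stepWord lo hi 0 (K N) ∈ F)
    (hQ : ∀ N lo hi lo' hi', IsStair N lo hi → IsStair N lo' hi' → Q N lo hi → Q N lo' hi' →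
      lo N = lo' N → (∀ s ≤ K N, lo s = lo' s ∧ hi s = hi' s) →
      ∀ p ∈ stairSet N lo hi, p ∈ stairSet N lo' hi') :
    X.ncard ≤ (n + 1) ^ 2 * F.card := by
  choose! N lo hi hstair hmk hq hN hw using hX
  have hmaps : ∀ c ∈ X, (((lo c (N c), N c - lo c (N c)), stepWord (lo c) (hi c) 0 (K (N c))) :
      Cell × List (Bool × Bool)) ∈ ((Finset.Icc (0 : Cell) (n, n) ×ˢ F :
        Finset (Cell × List (Bool × Bool))) : Set (Cell × List (Bool × Bool))) := by
    intro c hc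
    rw [Finset.mem_coe, Finset.mem_product, Finset.mem_Icc]
    have h1 := (hstair c hc).lo_nonneg (N c)
    have h2 := ((hstair c hc).lo_le_hi (N c)).trans ((hstair c hc).hi_le (N c))
    have h3 := hN c hc
    exact ⟨⟨(hstair c hc).isLeast.2 (hstair c hc).last_mem,
      ⟨by simp only; omega, by simp only; omega⟩⟩, hw c hc⟩
  have hinj : Set.InjOn (fun c => (((lo c (N c), N c - lo c (N c)),
      stepWord (lo c) (hi c) 0 (K (N c))) : Cell × List (Bool × Bool))) X := by
    intro c hc c' hc' e
    simp only [Prod.mk.injEq] at e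
    -- `N` is the coordinate sum of the top-right cell.
    have hNN : N c = N c' := by omega
    have hs := hstair c hc
    have hs' := hstair c' hc'
    have hq1 := hq c hc
    have hq2 := hq c' hc'
    have hm := hmk c hc
    have hm' := hmk c' hc'
    rw [hNN] at hs hq1 e hm
    have hends := fun s (h : s ≤ K (N c')) => hs.ends_eq_of_stepWord_eq hs' e.2 h
    refine hm.symm.trans (Eq.trans (congrArg _ (Finset.ext fun p => ?_)) hm')
    exact ⟨hQ _ _ _ _ _ hs hs' hq1 hq2 e.1.1 hends p,
      hQ _ _ _ _ _ hs' hs hq2 hq1 e.1.1.symm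
        (fun s h => ⟨(hends s h).1.symm, (hends s h).2.symm⟩) p⟩
  have := Set.ncard_le_ncard_of_injOn _ hmaps hinj (Finset.finite_toSet _)
  refine this.trans (le_of_eq ?_)
  rw [Set.ncard_coe_finset, Finset.card_product]
  congr 1
  rw [show (0 : Cell) = ((0 : ℤ), (0 : ℤ)) from rfl, Finset.card_Icc_prod]
  simp only [Int.card_Icc]
  rw [sq]
  congr 1

/-! ### Effect of the symmetries on the slices. -/

theorem exists_of_move_eq {g : Cell ≃ₗ[ℤ] Cell} (hg : ∀ p, g (g p) = p) {T : Finset Cell}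
    (h : TranslationClass.move g ⟦T⟧ = ⟦T⟧) : ∃ v : Cell, ∀ p, p ∈ T ↔ g (-v + p) ∈ T := by
  obtain ⟨v, hv⟩ := Quotient.exact (show (⟦moveCells g T⟧ : TranslationClass) = ⟦T⟧ from h)
  refine ⟨v, fun p => ?_⟩
  nth_rewrite 1 [← hv]
  rw [mem_translateCells, moveCells, Finset.mem_map]
  constructor
  · rintro ⟨q, hq, e⟩
    rw [← e]
    simpa [hg] using hq
  · intro hp
    exact ⟨_, hp, hg _⟩

namespace IsStair

variable {N : ℕ} {lo hi : ℕ → ℤ} {g : Cell ≃ₗ[ℤ] Cell}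

theorem sum_mem {p : Cell} (hp : p ∈ stairSet N lo hi) :
    0 ≤ p.1 + p.2 ∧ p.1 + p.2 ≤ N := by
  obtain ⟨s, hs, h1, -⟩ := mem_stairSet.1 hp
  omega

/-- A class invariant under an involution that reverses the order of the antidiagonals. -/
theorem mem_iff_of_reversal (h : IsStair N lo hi) (hg : ∀ p, g (g p) = p)
    (hsum : ∀ p, (g p).1 + (g p).2 = -(p.1 + p.2))
    (hm : TranslationClass.move g ⟦stairSet N lo hi⟧ = ⟦stairSet N lo hi⟧) (p : Cell) :
    p ∈ stairSet N lo hi ↔ ((lo N, N - lo N) : Cell) + g p ∈ stairSet N lo hi := by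
  obtain ⟨v, hv⟩ := exists_of_move_eq hg hm
  -- The image `g (-v)` of `0` lies in the set, hence below the top-right cell. The image of the
  -- top-right cell has nonnegative coordinate sum, so `g (-v)` has coordinate sum at least `N`;
  -- thus the two cells agree.
  have h0 := (hv 0).1 h.zero_mem
  have h1 := (hv _).1 h.last_mem
  rw [map_add] at h1
  rw [add_zero] at h0
  have h2 := (sum_mem h1).1
  have h3 := hsum (lo N, N - lo N)
  have h4 := h.isGreatest.2 h0
  have h5 : (g (-v)).1 ≤ lo N := h4.1
  have h6 : (g (-v)).2 ≤ N - lo N := h4.2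
  simp only [Prod.fst_add, Prod.snd_add] at h2 h3
  have h7 : g (-v) = (lo N, N - lo N) := Prod.ext (by simp only; omega) (by simp only; omega)
  rw [hv p, map_add, h7]

/-- No translation is needed: the image of `0` has nonnegative coordinates, and that of the
top-right cell has sum at most `N`, which forces the vector to vanish. -/
theorem mem_iff_swap (h : IsStair N lo hi)
    (hm : TranslationClass.move symD2 ⟦stairSet N lo hi⟧ = ⟦stairSet N lo hi⟧) (x y : ℤ) :
    (x, y) ∈ stairSet N lo hi ↔ (y, x) ∈ stairSet N lo hi := by
  obtain ⟨v, hv⟩ := exists_of_move_eq (g := symD2) (fun p => rfl) hm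
  obtain ⟨a, b⟩ := v
  have h0 := (hv 0).1 h.zero_mem
  have h1 := (hv _).1 h.last_mem
  have e0 : symD2 (-(a, b) + 0) = (-b, -a) := by simp [symD2]
  have e1 : symD2 (-(a, b) + (lo N, N - lo N)) = (-b + (N - lo N), -a + lo N) := by simp [symD2]
  rw [e0] at h0
  rw [e1] at h1
  have h2 := (sum_mem h1).2
  have h3 : 0 ≤ -b ∧ 0 ≤ -a := h.isLeast.2 h0
  simp only at h2
  obtain ⟨rfl, rfl⟩ : a = 0 ∧ b = 0 := by omega
  rw [hv]
  simp [symD2]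

theorem lo_add_hi_of_swap (h : IsStair N lo hi)
    (hm : TranslationClass.move symD2 ⟦stairSet N lo hi⟧ = ⟦stairSet N lo hi⟧) {s : ℕ}
    (hs : s ≤ N) : lo s + hi s = s := by
  have h1 := (h.mem_iff_swap hm _ _).1 ((mem_stairSet_of_add_eq (N := N) (s := s) (x := lo s)
    (y := s - lo s) (by ring)).2 ⟨hs, le_rfl, h.lo_le_hi s⟩)
  have h2 := (h.mem_iff_swap hm _ _).1 ((mem_stairSet_of_add_eq (N := N) (s := s) (x := hi s)
    (y := s - hi s) (by ring)).2 ⟨hs, h.lo_le_hi s, le_rfl⟩)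
  rw [mem_stairSet_of_add_eq (s := s) (by ring)] at h1 h2
  omega

/-- The slices before `N / 2` and their images, which lie on slices beyond the middle, are disjoint
parts of equal size. -/
theorem two_mul_sum_le_card (h : IsStair N lo hi) (hsum : ∀ p, (g p).1 + (g p).2 = -(p.1 + p.2))
    (hsym : ∀ p, p ∈ stairSet N lo hi ↔ ((lo N, N - lo N) : Cell) + g p ∈ stairSet N lo hi) :
    2 * ∑ i ∈ Finset.range (N / 2), (hi i - lo i + 1) ≤ (stairSet N lo hi).card := by
  rcases Nat.eq_zero_or_pos (N / 2) with h0 | h0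
  · simp [h0]
  have hcard := card_stairSet (N := N / 2 - 1) h.lo_le_hi
  rw [Nat.sub_add_cancel h0] at hcard
  let b : Cell := (lo N, N - lo N)
  have hsub : stairSet (N / 2 - 1) lo hi ⊆ stairSet N lo hi := by
    intro p hp
    obtain ⟨s, hs, h1⟩ := mem_stairSet.1 hp
    exact mem_stairSet.2 ⟨s, by omega, h1⟩
  have hinj : Function.Injective fun p => b + g p := fun p q e => g.injective (add_left_cancel e)
  have hsub' : (stairSet (N / 2 - 1) lo hi).image (fun p => b + g p) ⊆ stairSet N lo hi := by
    intro p hp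
    obtain ⟨q, hq, rfl⟩ := Finset.mem_image.1 hp
    exact (hsym q).1 (hsub hq)
  have hdisj : Disjoint (stairSet (N / 2 - 1) lo hi)
      ((stairSet (N / 2 - 1) lo hi).image fun p => b + g p) := by
    rw [Finset.disjoint_left]
    intro p hp hp'
    obtain ⟨q, hq, rfl⟩ := Finset.mem_image.1 hp'
    obtain ⟨s, hs, h1, -⟩ := mem_stairSet.1 hp
    obtain ⟨t, ht, h2, -⟩ := mem_stairSet.1 hq
    have := hsum q
    simp only [b, Prod.fst_add, Prod.snd_add] at h1
    omega
  have := Finset.card_le_card (Finset.union_subset hsub hsub')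
  rw [Finset.card_union_of_disjoint hdisj, Finset.card_image_of_injective _ hinj] at this
  omega

end IsStair

/-- Invariance under an involution reversing the order of the antidiagonals: the class is
determined by its top-right cell and the first half of its antidiagonals. -/
theorem ncard_le_of_reversal {g : Cell ≃ₗ[ℤ] Cell} (hg : ∀ p, g (g p) = p)
    (hsum : ∀ p, (g p).1 + (g p).2 = -(p.1 + p.2)) {X : Set TranslationClass} {n : ℕ}
    {F : Finset (List (Bool × Bool))}
    (hX : ∀ c ∈ X, c.IsParallelogram ∧ TranslationClass.move g c = c)
    (hF : ∀ N lo hi, IsStair N lo hi → ⟦stairSet N lo hi⟧ ∈ X →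
      (∀ p, p ∈ stairSet N lo hi ↔ ((lo N, N - lo N) : Cell) + g p ∈ stairSet N lo hi) →
      N ≤ n ∧ stepWord lo hi 0 (N / 2) ∈ F) :
    X.ncard ≤ (n + 1) ^ 2 * F.card := by
  refine ncard_le_of_stepWord (fun N lo hi => ∀ p, p ∈ stairSet N lo hi ↔
    ((lo N, N - lo N) : Cell) + g p ∈ stairSet N lo hi) (fun N => N / 2) ?_ ?_
  · intro c hc
    obtain ⟨N, lo, hi, h, rfl⟩ := TranslationClass.isParallelogram_iff.1 (hX c hc).1
    have hsym := h.mem_iff_of_reversal hg hsum (hX _ hc).2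
    exact ⟨N, lo, hi, h, rfl, hsym, hF N lo hi h hc hsym⟩
  · intro N lo hi lo' hi' h h' hsym hsym' hN hends
    have low : ∀ p ∈ stairSet N lo hi, p.1 + p.2 ≤ (N / 2 : ℕ) → p ∈ stairSet N lo' hi' := by
      intro p hp hle
      obtain ⟨s, hs, h1, h2⟩ := mem_stairSet.1 hp
      have := hends s (by omega)
      exact mem_stairSet.2 ⟨s, hs, h1, by omega⟩
    intro p hp
    rcases le_or_gt (p.1 + p.2) (N / 2 : ℕ) with hle | hlt
    · exact low p hp hle
    -- A cell past slice `N / 2` is reflected into the known half, about a centre fixed by the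
    -- common top-right cell.
    · rw [hsym', ← hN]
      refine low _ ((hsym p).1 hp) ?_
      have := hsum p
      simp only [Prod.fst_add, Prod.snd_add]
      omega

/-- The two steps that preserve the sum of the ends plus one. -/
def swapSteps : Finset (Bool × Bool) := {(true, false), (false, true)}

/-- The whole step word is kept here, so no reconstruction is needed; the gain is that `lo s + hi s
= s` makes exactly one end move at each step. -/
theorem ncard_le_of_swap {X : Set TranslationClass} {n : ℕ} {F : Finset (List (Bool × Bool))}
    (hX : ∀ c ∈ X, c.IsParallelogram ∧ TranslationClass.move symD2 c = c)
    (hF : ∀ N lo hi, IsStair N lo hi → ⟦stairSet N lo hi⟧ ∈ X →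
      (∀ t ∈ stepWord lo hi 0 N, t ∈ swapSteps) → N ≤ n ∧ stepWord lo hi 0 N ∈ F) :
    X.ncard ≤ (n + 1) ^ 2 * F.card := by
  refine ncard_le_of_stepWord (fun _ _ _ => True) (fun N => N) ?_ ?_
  · intro c hc
    obtain ⟨N, lo, hi, h, rfl⟩ := TranslationClass.isParallelogram_iff.1 (hX c hc).1
    refine ⟨N, lo, hi, h, rfl, trivial, hF N lo hi h hc (mem_of_mem_stepWord fun i _ hiN => ?_)⟩
    have h1 := h.lo_add_hi_of_swap (hX _ hc).2 (s := i) (by omega)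
    have h2 := h.lo_add_hi_of_swap (hX _ hc).2 (s := i + 1) (by omega)
    have h3 := h.lo_le_succ i
    have h4 := h.hi_le_succ i
    push_cast at h2
    rcases (by omega : (lo i < lo (i + 1) ∧ ¬ hi i < hi (i + 1)) ∨
      (¬ lo i < lo (i + 1) ∧ hi i < hi (i + 1))) with ⟨e1, e2⟩ | ⟨e1, e2⟩ <;>
      simp [swapSteps, e1, e2]
  · intro N lo hi lo' hi' _ _ _ _ _ hends p hp
    obtain ⟨s, hs, h1, h2⟩ := mem_stairSet.1 hp
    have := hends s hs
    exact mem_stairSet.2 ⟨s, hs, h1, by omega⟩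

theorem card_swapSteps : swapSteps.card = 2 := rfl

theorem card_univ_steps : (Finset.univ : Finset (Bool × Bool)).card = 4 := rfl

/-! ### Upper bounds for one symmetry. -/

/-- The number of classes of area `n` invariant under `g`. -/
theorem ncard_area_le_of_reversal {g : Cell ≃ₗ[ℤ] Cell} (hg : ∀ p, g (g p) = p)
    (hsum : ∀ p, (g p).1 + (g p).2 = -(p.1 + p.2)) (n : ℕ) :
    (({c : TranslationClass | c.IsParallelogram ∧ c.move g = c ∧ c.area = n}.ncard : ℕ) : ℝ) ≤
      2 * ((n : ℝ) + 1) ^ 2 * (7 / 4) ^ n := by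
  -- With four letters, `c = 3` is the least value with `T.card ≤ c + 1`; the budget `n / 2` is half
  -- the area.
  obtain ⟨F, hF, hcard⟩ := exists_finset_admissibleWord (T := Finset.univ) (c := 3)
    (Finset.mem_univ _) (by norm_num) (by rw [card_univ_steps]; norm_num)
    (by rw [card_univ_steps]; norm_num) (by rw [card_univ_steps]; norm_num)
    (by rw [card_univ_steps]; norm_num) (n / 2) 1 le_rfl
  have h := ncard_le_of_reversal hg hsum (n := n) (F := F)
    (X := {c : TranslationClass | c.IsParallelogram ∧ c.move g = c ∧ c.area = n})
    (fun c hc => ⟨hc.1, hc.2.1⟩) (by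
      intro N lo hi hs hc hsym
      have ha : (stairSet N lo hi).card = n := hc.2.2
      have h1 := hs.lt_card
      have h2 := hs.two_mul_sum_le_card hsum hsym
      refine ⟨by omega, hF _ (hs.admissibleWord_stepWord (fun t _ => Finset.mem_univ t) ?_ ?_)⟩
      · simp [hs.lo_zero, hs.hi_zero]
      · simp only [zero_add]
        omega)
  -- This uses `3 ≤ (7 / 4) ^ 2 = 49 / 16`.
  have h3 : (3 : ℝ) ^ (n / 2) ≤ (7 / 4) ^ n := by
    calc (3 : ℝ) ^ (n / 2) ≤ ((7 / 4) ^ 2) ^ (n / 2) :=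
          pow_le_pow_left₀ (by norm_num) (by norm_num) _
      _ = (7 / 4) ^ (2 * (n / 2)) := (pow_mul _ _ _).symm
      _ ≤ (7 / 4) ^ n := pow_le_pow_right₀ (by norm_num) (by omega)
  have hF' : (F.card : ℝ) ≤ 2 * (7 / 4) ^ n := by linarith
  calc _ ≤ (((n + 1) ^ 2 * F.card : ℕ) : ℝ) := Nat.cast_le.2 h
    _ = ((n : ℝ) + 1) ^ 2 * F.card := by push_cast; ring
    _ ≤ ((n : ℝ) + 1) ^ 2 * (2 * (7 / 4) ^ n) := by gcongr
    _ = _ := by ring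

theorem ncard_area_le_of_swap (n : ℕ) :
    (({c : TranslationClass | c.IsParallelogram ∧ c.move symD2 = c ∧ c.area = n}.ncard : ℕ) : ℝ) ≤
      2 * ((n : ℝ) + 1) ^ 2 * (7 / 4) ^ n := by
  -- With two letters any `c ≥ 3 / 2` is allowed; `7 / 4` matches the bound for reversals and stays
  -- below the growth rate `2`.
  obtain ⟨F, hF, hcard⟩ := exists_finset_admissibleWord (T := swapSteps) (c := 7 / 4)
    (by simp [swapSteps]) (by norm_num) (by rw [card_swapSteps]; norm_num)
    (by rw [card_swapSteps]; norm_num) (by rw [card_swapSteps]; norm_num)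
    (by rw [card_swapSteps]; norm_num) n 1 le_rfl
  have h := ncard_le_of_swap (n := n) (F := F)
    (X := {c : TranslationClass | c.IsParallelogram ∧ c.move symD2 = c ∧ c.area = n})
    (fun c hc => ⟨hc.1, hc.2.1⟩) (by
      intro N lo hi hs hc hT
      have ha : (stairSet N lo hi).card = n := hc.2.2
      have h1 := hs.lt_card
      have h2 := card_stairSet (N := N) hs.lo_le_hi
      rw [Finset.sum_range_succ] at h2
      have h3 := hs.lo_le_hi N
      refine ⟨by omega, hF _ (hs.admissibleWord_stepWord hT ?_ ?_)⟩
      · simp [hs.lo_zero, hs.hi_zero]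
      · simp only [zero_add]
        omega)
  have hF' : (F.card : ℝ) ≤ 2 * (7 / 4) ^ n := by linarith
  calc _ ≤ (((n + 1) ^ 2 * F.card : ℕ) : ℝ) := Nat.cast_le.2 h
    _ = ((n : ℝ) + 1) ^ 2 * F.card := by push_cast; ring
    _ ≤ ((n : ℝ) + 1) ^ 2 * (2 * (7 / 4) ^ n) := by gcongr
    _ = _ := by ring

theorem ncard_halfPerimeter_le_of_reversal {g : Cell ≃ₗ[ℤ] Cell} (hg : ∀ p, g (g p) = p)
    (hsum : ∀ p, (g p).1 + (g p).2 = -(p.1 + p.2)) (n : ℕ) :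
    {c : TranslationClass | c.IsParallelogram ∧ c.move g = c ∧ c.halfPerimeter = n}.ncard ≤
      (n + 1) ^ 2 * 2 ^ n := by
  obtain ⟨F, hF, hcard⟩ := exists_finset_words Finset.univ ((n - 2) / 2)
  refine (ncard_le_of_reversal hg hsum (n := n) (F := F) (fun c hc => ⟨hc.1, hc.2.1⟩) ?_).trans ?_
  · intro N lo hi hs hc _
    have ha : width (stairSet N lo hi) + height (stairSet N lo hi) = n := hc.2.2
    have h1 := hs.width_add_height
    refine ⟨by omega, hF _ ?_ fun t _ => Finset.mem_univ t⟩
    rw [length_stepWord]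
    omega
  · refine Nat.mul_le_mul_left _ (hcard.trans ?_)
    rw [card_univ_steps, show 4 = 2 ^ 2 from rfl, ← pow_mul]
    exact Nat.pow_le_pow_right (by norm_num) (by omega)

theorem ncard_halfPerimeter_le_of_swap (n : ℕ) :
    {c : TranslationClass | c.IsParallelogram ∧ c.move symD2 = c ∧ c.halfPerimeter = n}.ncard ≤
      (n + 1) ^ 2 * 2 ^ n := by
  obtain ⟨F, hF, hcard⟩ := exists_finset_words swapSteps (n - 2)
  refine (ncard_le_of_swap (n := n) (F := F) (fun c hc => ⟨hc.1, hc.2.1⟩) ?_).trans ?_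
  · intro N lo hi hs hc hT
    have ha : width (stairSet N lo hi) + height (stairSet N lo hi) = n := hc.2.2
    have h1 := hs.width_add_height
    refine ⟨by omega, hF _ ?_ hT⟩
    rw [length_stepWord]
    omega
  · refine Nat.mul_le_mul_left _ (hcard.trans ?_)
    rw [card_swapSteps]
    exact Nat.pow_le_pow_right (by norm_num) (by omega)

/-! ### Comparison of the growth rates. -/

theorem exists_mem_of_ne_bot {H : Subgroup (Cell ≃ₗ[ℤ] Cell)} (hH : H ≤ groupD2) (hne : H ≠ ⊥) :
    ∃ g ∈ H, g = symD2 ∨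
      ((∀ p, g (g p) = p) ∧ ∀ p, (g p).1 + (g p).2 = -(p.1 + p.2)) := by
  obtain ⟨⟨g, hg⟩, hg1⟩ := Subgroup.ne_bot_iff_exists_ne_one.1 hne
  refine ⟨g, hg, ?_⟩
  rcases (mem_groupD2 g).1 (hH hg) with e | e | e | e
  · exact absurd (Subtype.ext e) hg1
  · right
    rw [e]
    exact ⟨fun p => by simp [symR2], fun p => by simp [symR2]; ring⟩
  · right
    rw [e]
    exact ⟨fun p => by simp [symD1], fun p => by simp [symD1]⟩
  · exact Or.inl e

theorem symmetricCountByArea_le {H : Subgroup (Cell ≃ₗ[ℤ] Cell)} (hH : H ≤ groupD2) (hne : H ≠ ⊥)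
    (n : ℕ) : (symmetricCountByArea H n : ℝ) ≤ 2 * ((n : ℝ) + 1) ^ 2 * (7 / 4) ^ n := by
  obtain ⟨g, hg, h⟩ := exists_mem_of_ne_bot hH hne
  have h1 : symmetricCountByArea H n ≤
      {c : TranslationClass | c.IsParallelogram ∧ c.move g = c ∧ c.area = n}.ncard :=
    Set.ncard_le_ncard (fun c hc => ⟨hc.1, hc.2.1 g hg, hc.2.2⟩)
      ((TranslationClass.finite_isParallelogram_area n).subset fun c hc => ⟨hc.1, hc.2.2⟩)
  refine (Nat.cast_le.2 h1).trans ?_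
  rcases h with rfl | ⟨h2, h3⟩
  · exact ncard_area_le_of_swap n
  · exact ncard_area_le_of_reversal h2 h3 n

theorem symmetricCountByHalfPerimeter_le {H : Subgroup (Cell ≃ₗ[ℤ] Cell)} (hH : H ≤ groupD2)
    (hne : H ≠ ⊥) (n : ℕ) : symmetricCountByHalfPerimeter H n ≤ (n + 1) ^ 2 * 2 ^ n := by
  obtain ⟨g, hg, h⟩ := exists_mem_of_ne_bot hH hne
  have h1 : symmetricCountByHalfPerimeter H n ≤
      {c : TranslationClass | c.IsParallelogram ∧ c.move g = c ∧ c.halfPerimeter = n}.ncard :=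
    Set.ncard_le_ncard (fun c hc => ⟨hc.1, hc.2.1 g hg, hc.2.2⟩)
      ((TranslationClass.finite_isParallelogram_halfPerimeter n).subset fun c hc => ⟨hc.1, hc.2.2⟩)
  refine h1.trans ?_
  rcases h with rfl | ⟨h2, h3⟩
  · exact ncard_halfPerimeter_le_of_swap n
  · exact ncard_halfPerimeter_le_of_reversal h2 h3 n

theorem tendsto_const_mul_sq_mul_pow {r : ℝ} (C : ℝ) (h0 : 0 ≤ r) (h1 : r < 1) :
    Tendsto (fun n : ℕ => C * (((n : ℝ) + 1) ^ 2 * r ^ n)) atTop (𝓝 0) := by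
  have e2 := tendsto_pow_const_mul_const_pow_of_lt_one 2 h0 h1
  have e1 := tendsto_pow_const_mul_const_pow_of_lt_one 1 h0 h1
  have e0 := tendsto_pow_atTop_nhds_zero_of_lt_one h0 h1
  have := ((e2.add (e1.const_mul 2)).add e0).const_mul C
  simp only [mul_zero, add_zero] at this
  refine this.congr fun n => ?_
  ring

theorem mainTheorem4 (H : Subgroup (Cell ≃ₗ[ℤ] Cell)) (hH : H ≤ groupD2) (hne : H ≠ ⊥) :
    Tendsto (fun n : ℕ => (symmetricCountByArea H n : ℝ) / (countByArea n : ℝ))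
        atTop (𝓝 0) ∧
      Tendsto (fun n : ℕ =>
          (symmetricCountByHalfPerimeter H n : ℝ) / (countByHalfPerimeter n : ℝ))
        atTop (𝓝 0) := by
  constructor
  -- The ratio is `7 / 8 = (7 / 4) / 2`, and `8 = 2 * 2 ^ 2` collects the factor `2` of the upper
  -- bound and the index shift `n = m + 2`.
  · refine squeeze_zero' (Eventually.of_forall fun n => by positivity) ?_
      (tendsto_const_mul_sq_mul_pow (r := 7 / 8) 8 (by norm_num) (by norm_num))
    filter_upwards [eventually_ge_atTop 2] with n hn
    obtain ⟨m, rfl⟩ := Nat.exists_eq_add_of_le' hn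
    have h1 : (2 : ℝ) ^ m ≤ countByArea (m + 2) := by exact_mod_cast pow_le_countByArea m
    have h2 := symmetricCountByArea_le hH hne (m + 2)
    have hpos : (0 : ℝ) < 2 ^ m := by positivity
    rw [div_le_iff₀ (hpos.trans_le h1)]
    have e : (7 / 4 : ℝ) ^ (m + 2) = (7 / 8) ^ (m + 2) * (4 * 2 ^ m) := by
      rw [show (4 : ℝ) * 2 ^ m = 2 ^ (m + 2) by ring, ← mul_pow]; norm_num
    calc _ ≤ _ := h2
      _ = 8 * ((((m + 2 : ℕ) : ℝ) + 1) ^ 2 * (7 / 8) ^ (m + 2)) * 2 ^ m := by rw [e]; ring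
      _ ≤ _ := by gcongr
  -- Here `27 = 3 ^ 3` compensates the index shift `n = m + 3`.
  · refine squeeze_zero' (Eventually.of_forall fun n => by positivity) ?_
      (tendsto_const_mul_sq_mul_pow (r := 2 / 3) 27 (by norm_num) (by norm_num))
    filter_upwards [eventually_ge_atTop 3] with n hn
    obtain ⟨m, rfl⟩ := Nat.exists_eq_add_of_le' hn
    have h1 : (3 : ℝ) ^ m ≤ countByHalfPerimeter (m + 3) := by
      exact_mod_cast pow_le_countByHalfPerimeter m
    have h2 : (symmetricCountByHalfPerimeter H (m + 3) : ℝ) ≤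
        (((m + 3 : ℕ) : ℝ) + 1) ^ 2 * 2 ^ (m + 3) := by
      exact_mod_cast symmetricCountByHalfPerimeter_le hH hne (m + 3)
    have hpos : (0 : ℝ) < 3 ^ m := by positivity
    rw [div_le_iff₀ (hpos.trans_le h1)]
    have e : (2 : ℝ) ^ (m + 3) = (2 / 3) ^ (m + 3) * (27 * 3 ^ m) := by
      rw [show (27 : ℝ) * 3 ^ m = 3 ^ (m + 3) by ring, ← mul_pow]; norm_num
    calc _ ≤ _ := h2
      _ = 27 * ((((m + 3 : ℕ) : ℝ) + 1) ^ 2 * (2 / 3) ^ (m + 3)) * 3 ^ m := by rw [e]; ring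
      _ ≤ _ := by gcongr
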